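/- Let $(\Omega,\mathcal F,(\mathcal F_t)_{t\ge 0},P)$ be a filtered probability space satisfying the usual conditions: $(\mathcal F_t)$ is right-continuous and $\mathcal F_0$ contains every subset of a $P$-null set. Let $M$ be a càdlàg martingale with $M_0=0$ which is bounded, i.e. there is $c$ with $|M_t|\le c$ for all $t\ge 0$. Write $\Delta X_t=X_t-X_{t-}$, with $\Delta X_0=0$. Then there is a càdlàg adapted increasing process $[M]$ with $[M]_0=0$ and $E[M]_\infty<\infty$, where $[M]_\infty=\lim_{t\to\infty}[M]_t$, such that 1. $M^2-[M]$ is a square-integrable càdlàg martingale with initial value zero, i.e. a martingale with $\sup_{t\ge0}E(M_t^2-[M]_t)^2<\infty$; 2. almost surely, $\Delta[M]_t=(\Delta M_t)^2$ for all $t\ge 0$. It is unique up to indistinguishability: if $B$ is another càdlàg adapted increasing process with $B_0=0$ and $EB_\infty<\infty$ that satisfies 1 and 2 in place of $[M]$, then almost surely $B_t=[M]_t$ for all $t\ge0$. Moreover, $[M]=M^2-N$, where $N$ is an $L^2$ limit of convex combinations of the dyadic discrete stochastic integrals $$N^n_t=2\sum_{k=1}^\infty M_{t\wedge (k-1)2^{-n}}\bigl(M_{t\wedge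 k2^{-n}}-M_{t\wedge (k-1)2^{-n}}\bigr),\qquad n\ge 0:$$ for each $n\ge0$ there are $K_n\ge n$ and weights $\lambda^n_n,\dots,\lambda^n_{K_n}\ge 0$ with $\sum_{i=n}^{K_n}\lambda^n_i=1$ such that $$\sup_{t\ge0}E\Bigl(N_t-\sum_{i=n}^{K_n}\lambda^n_iN^i_t\Bigr)^2\longrightarrow 0\qquad(n\to\infty).$$ -/

import Mathlib

open MeasureTheory Filter Topology
open scoped NNReal ENNReal

namespace QuadVar

variable {Ω : Type*} {mΩ : MeasurableSpace Ω}

/-- The usual conditions: the filtration is right-continuous, and every subset of `Ω` of outer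
measure zero belongs to `ℱ 0`. In particular the underlying probability space is complete. -/
structure UsualConditions (ℱ : Filtration ℝ≥0 mΩ) (P : Measure Ω) : Prop where
  rightCont : ℱ.IsRightContinuous
  null : ∀ s : Set Ω, P s = 0 → MeasurableSet[ℱ 0] s

/-- A function on `[0, ∞)` is càdlàg if it is right-continuous with (finite) left limits.
At time `0` the left limit condition is void. -/
def IsCadlag (f : ℝ≥0 → ℝ) : Prop :=
  ∀ t, ContinuousWithinAt f (Set.Ici t) t ∧ ∃ l : ℝ, Tendsto f (𝓝[<] t) (𝓝 l)

/-- The jump `Δf(t) = f(t) - f(t-)`, with `f(0-) = f(0)`, so that `Δf(0) = 0`. -/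
noncomputable def jump (f : ℝ≥0 → ℝ) (t : ℝ≥0) : ℝ :=
  f t - Function.leftLim f t

/-- Two processes are indistinguishable if their sample paths are almost surely equal. -/
def Indistinguishable (P : Measure Ω) (X Y : ℝ≥0 → Ω → ℝ) : Prop :=
  ∀ᵐ ω ∂P, ∀ t, X t ω = Y t ω

/-- The terminal value `A_∞ ∈ [0, ∞]`; for a nonnegative increasing process the supremum is the
limit of `A_t` as `t → ∞`. -/
noncomputable def terminal (A : ℝ≥0 → Ω → ℝ) (ω : Ω) : ℝ≥0∞ :=
  ⨆ t, ENNReal.ofReal (A t ω)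

/-- Integrable increasing processes: adapted, with increasing càdlàg paths starting at zero, and
with integrable terminal value. -/
structure IsIntegrableIncreasing (ℱ : Filtration ℝ≥0 mΩ) (P : Measure Ω)
    (A : ℝ≥0 → Ω → ℝ) : Prop where
  adapted : StronglyAdapted ℱ A
  cadlag : ∀ ω, IsCadlag fun t => A t ω
  zero : ∀ ω, A 0 ω = 0
  mono : ∀ ω, Monotone fun t => A t ω
  integrable : ∫⁻ ω, terminal A ω ∂P < ∞

/-- Square-integrable (that is, bounded in `L²`) càdlàg martingales with initial value zero. -/
structure IsSqMartingale (ℱ : Filtration ℝ≥0 mΩ) (P : Measure Ω)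
    (N : ℝ≥0 → Ω → ℝ) : Prop where
  martingale : Martingale N ℱ P
  cadlag : ∀ ω, IsCadlag fun t => N t ω
  zero : ∀ ω, N 0 ω = 0
  bounded : ⨆ t, eLpNorm (N t) 2 P < ∞

/-- `A` is a quadratic variation process of `M`: it is an integrable increasing process,
`M² - A` is a square-integrable martingale with initial value zero, and `ΔA = (ΔM)²` up to
indistinguishability. -/
structure IsQuadVar (ℱ : Filtration ℝ≥0 mΩ) (P : Measure Ω)
    (M A : ℝ≥0 → Ω → ℝ) : Prop where
  increasing : IsIntegrableIncreasing ℱ P A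
  martingale : IsSqMartingale ℱ P fun t ω => M t ω ^ 2 - A t ω
  jumps : Indistinguishable P (fun t ω => jump (fun s => A s ω) t)
    (fun t ω => jump (fun s => M s ω) t ^ 2)

/-- The dyadic time `k 2⁻ⁿ`. -/
noncomputable def dyadic (n k : ℕ) : ℝ≥0 := (k : ℝ≥0) / 2 ^ n

/-- The dyadic discrete stochastic integral
`Nⁿ_t = 2 ∑_{k ≥ 0} M_{t ∧ k2⁻ⁿ} (M_{t ∧ (k+1)2⁻ⁿ} - M_{t ∧ k2⁻ⁿ})`. The terms with `k2⁻ⁿ ≥ t`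
vanish, so that the sum is finite. -/
noncomputable def dyadicIntegral (M : ℝ≥0 → Ω → ℝ) (n : ℕ) (t : ℝ≥0) (ω : Ω) : ℝ :=
  2 * ∑' k : ℕ, M (min t (dyadic n k)) ω *
    (M (min t (dyadic n (k + 1))) ω - M (min t (dyadic n k)) ω)

end QuadVar

namespace QuadVar

/-! On the level-`n` grid, `M² - Nⁿ` is the running sum of squared increments of `M` (up to its
initial value), hence increasing there; and since `|M| ≤ c`, orthogonality of martingale increments
gives `E (Nⁿ_t)² ≤ 4c⁴` uniformly in `n` and `t` (`integral_dyadicIntegral_sq_le`).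

Boundedness alone gives no convergence of `Nⁿ`, but in a Hilbert space almost norm-minimal convex
combinations of the tails `Nⁿ, Nⁿ⁺¹, …` form a Cauchy sequence, by the parallelogram law
(`exists_cauchy_weights`). The norm used is `sup_t ‖·‖₂`. The maximal inequality and Borel–Cantelli
then give, along a subsequence, almost surely uniform convergence in time to a limit `N`
(`exists_ae_uniform_combinations`).

Uniform convergence carries the path properties over to `A = M² - N`: it is càdlàg, it increases
because every fixed grid is eventually contained in all grids in use, and `ΔN = 2 M₋ ΔM`, so that
`ΔA = (ΔM)²`. The martingale property passes through the `L²` limit.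

For uniqueness, the difference of two candidates is a martingale of finite variation whose jumps
cancel, so it is almost surely continuous. Its expected square equals the expected sum of squared
increments over any grid, which tends to zero with the mesh (`IsQuadVar.indistinguishable`). -/

/-! ### Dyadic times and dyadic integrals along a path -/

lemma monotone_dyadic (n : ℕ) : Monotone (dyadic n) := fun a b h => by
  unfold dyadic
  gcongr

lemma dyadic_eq_of_le {n i : ℕ} (h : n ≤ i) (j : ℕ) : dyadic n j = dyadic i (j * 2 ^ (i - n)) := by
  obtain ⟨d, rfl⟩ := Nat.exists_eq_add_of_le h
  simp only [dyadic, Nat.add_sub_cancel_left, pow_add]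
  push_cast
  field_simp

lemma dyadic_succ (n k : ℕ) : dyadic n (k + 1) = dyadic n k + (1 / 2) ^ n := by
  rw [dyadic, dyadic, one_div, inv_pow]
  push_cast
  rw [add_div, one_div]

lemma exists_dyadic_le_lt (n : ℕ) (t : ℝ≥0) : ∃ k, dyadic n k ≤ t ∧ t < dyadic n (k + 1) := by
  refine ⟨⌊t * 2 ^ n⌋₊, ?_, ?_⟩
  · unfold dyadic
    rw [div_le_iff₀ (by positivity)]
    exact Nat.floor_le (by positivity)
  · unfold dyadic
    rw [lt_div_iff₀ (by positivity)]
    push_cast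
    exact Nat.lt_floor_add_one _

lemma exists_dyadic_lt_le (n : ℕ) {t : ℝ≥0} (ht : 0 < t) :
    ∃ k, dyadic n k < t ∧ t ≤ dyadic n (k + 1) := by
  have h0 : 0 < t * 2 ^ n := by positivity
  obtain ⟨k, hk⟩ : ∃ k, ⌈t * 2 ^ n⌉₊ = k + 1 :=
    Nat.exists_eq_succ_of_ne_zero (Nat.ceil_pos.2 h0).ne'
  refine ⟨k, ?_, ?_⟩
  · unfold dyadic
    rw [div_lt_iff₀ (by positivity)]
    exact Nat.lt_ceil.1 (by omega)
  · unfold dyadic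
    rw [le_div_iff₀ (by positivity), ← hk]
    exact Nat.le_ceil _

lemma exists_le_dyadic (n : ℕ) (t : ℝ≥0) : ∃ k, t ≤ dyadic n k :=
  (exists_dyadic_le_lt n t).elim fun k hk => ⟨k + 1, hk.2.le⟩

/-- The dyadic discrete integral along a single path. -/
noncomputable def pathIntegral (m : ℝ≥0 → ℝ) (n : ℕ) (t : ℝ≥0) : ℝ :=
  2 * ∑' k : ℕ, m (min t (dyadic n k)) * (m (min t (dyadic n (k + 1))) - m (min t (dyadic n k)))

lemma pathIntegral_eq_sum (m : ℝ≥0 → ℝ) {n K : ℕ} {t : ℝ≥0} (h : t ≤ dyadic n K) :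
    pathIntegral m n t = 2 * ∑ k ∈ Finset.range K,
      m (min t (dyadic n k)) * (m (min t (dyadic n (k + 1))) - m (min t (dyadic n k))) := by
  unfold pathIntegral
  rw [tsum_eq_sum]
  intro k hk
  have hk : K ≤ k := by simpa using hk
  have h1 := h.trans (monotone_dyadic n hk)
  have h2 := h.trans (monotone_dyadic n (hk.trans k.le_succ))
  rw [min_eq_left h1, min_eq_left h2]
  simp

/-- Within one closed cell the integral is an affine function of `m t`, so one-sided limits of `m`
transfer to it. -/
lemma pathIntegral_eq (m : ℝ≥0 → ℝ) {n k : ℕ} {t : ℝ≥0} (h1 : dyadic n k ≤ t)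
    (h2 : t ≤ dyadic n (k + 1)) :
    pathIntegral m n t = 2 * (∑ j ∈ Finset.range k,
      m (dyadic n j) * (m (dyadic n (j + 1)) - m (dyadic n j)) +
      m (dyadic n k) * (m t - m (dyadic n k))) := by
  rw [pathIntegral_eq_sum m h2, Finset.sum_range_succ, min_eq_left h2, min_eq_right h1]
  congr 2
  refine Finset.sum_congr rfl fun j hj => ?_
  have hj : j < k := by simpa using hj
  rw [min_eq_right ((monotone_dyadic n hj.le).trans h1),
    min_eq_right ((monotone_dyadic n (Nat.succ_le_of_lt hj)).trans h1)]

lemma pathIntegral_zero (m : ℝ≥0 → ℝ) (n : ℕ) : pathIntegral m n 0 = 0 := by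
  rw [pathIntegral_eq_sum m (K := 0) (by simp)]
  simp

/-- With `a`, `b` the values at consecutive grid points, the increment is `b² - a² - 2a(b - a) = (b
- a)²`. -/
lemma monotone_sq_sub_pathIntegral (m : ℝ≥0 → ℝ) (n : ℕ) :
    Monotone fun k => m (dyadic n k) ^ 2 - pathIntegral m n (dyadic n k) := by
  refine monotone_nat_of_le_succ fun k => ?_
  rw [pathIntegral_eq m le_rfl (monotone_dyadic n k.le_succ),
    pathIntegral_eq m (monotone_dyadic n k.le_succ) le_rfl]
  nlinarith [sq_nonneg (m (dyadic n (k + 1)) - m (dyadic n k))]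

lemma pathIntegral_rightCont {m : ℝ≥0 → ℝ} {t : ℝ≥0} (hm : ContinuousWithinAt m (Set.Ici t) t)
    (n : ℕ) : ContinuousWithinAt (pathIntegral m n) (Set.Ici t) t := by
  obtain ⟨k, h1, h2⟩ := exists_dyadic_le_lt n t
  have : ContinuousWithinAt (fun s => 2 * (∑ j ∈ Finset.range k,
      m (dyadic n j) * (m (dyadic n (j + 1)) - m (dyadic n j)) +
      m (dyadic n k) * (m s - m (dyadic n k)))) (Set.Ici t) t := by fun_prop
  refine this.congr_of_eventuallyEq ?_ (pathIntegral_eq m h1 h2.le)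
  filter_upwards [self_mem_nhdsWithin, mem_nhdsWithin_of_mem_nhds (Iio_mem_nhds h2)] with s hs hs'
  exact pathIntegral_eq m (h1.trans hs) (Set.mem_Iio.1 hs').le

lemma tendsto_pathIntegral_left {m : ℝ≥0 → ℝ} {t : ℝ≥0} {l : ℝ}
    (hm : Tendsto m (𝓝[<] t) (𝓝 l)) {n k : ℕ} (h1 : dyadic n k < t) (h2 : t ≤ dyadic n (k + 1)) :
    Tendsto (pathIntegral m n) (𝓝[<] t)
      (𝓝 (pathIntegral m n t - 2 * m (dyadic n k) * (m t - l))) := by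
  have : Tendsto (fun s => 2 * (∑ j ∈ Finset.range k,
      m (dyadic n j) * (m (dyadic n (j + 1)) - m (dyadic n j)) +
      m (dyadic n k) * (m s - m (dyadic n k)))) (𝓝[<] t) (𝓝 (2 * (∑ j ∈ Finset.range k,
      m (dyadic n j) * (m (dyadic n (j + 1)) - m (dyadic n j)) +
      m (dyadic n k) * (l - m (dyadic n k))))) :=
    ((((hm.sub_const _).const_mul _).const_add _).const_mul _)
  have e : pathIntegral m n t - 2 * m (dyadic n k) * (m t - l) = 2 * (∑ j ∈ Finset.range k,
      m (dyadic n j) * (m (dyadic n (j + 1)) - m (dyadic n j)) +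
      m (dyadic n k) * (l - m (dyadic n k))) := by
    rw [pathIntegral_eq m h1.le h2]; ring
  rw [e]
  refine this.congr' ?_
  filter_upwards [self_mem_nhdsWithin, mem_nhdsWithin_of_mem_nhds (Ioi_mem_nhds h1)] with s hs hs'
  exact (pathIntegral_eq m (Set.mem_Ioi.1 hs').le ((Set.mem_Iio.1 hs).le.trans h2)).symm

/-! ### Tail convex combinations and their uniform limits -/

/-- Convex weights supported in `[n, ∞)`. -/
def tailSimplex (n : ℕ) : Set (ℕ →₀ ℝ) :=
  {w | (∀ i, 0 ≤ w i) ∧ (∀ i < n, w i = 0) ∧ (w.sum fun _ a => a) = 1}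

lemma abs_sum_sub_le {n : ℕ} {w : ℕ →₀ ℝ} (hw : w ∈ tailSimplex n) {a : ℕ → ℝ} {l ε : ℝ}
    (h : ∀ i, n ≤ i → |a i - l| ≤ ε) : |(w.sum fun i x => x * a i) - l| ≤ ε := by
  obtain ⟨h0, hn, h1⟩ := hw
  simp only [Finsupp.sum] at *
  have e : ∑ i ∈ w.support, w i * a i - l = ∑ i ∈ w.support, w i * (a i - l) := by
    simp_rw [mul_sub]
    rw [Finset.sum_sub_distrib, ← Finset.sum_mul, h1, one_mul]
  rw [e]
  calc |∑ i ∈ w.support, w i * (a i - l)| ≤ ∑ i ∈ w.support, |w i * (a i - l)| :=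
        Finset.abs_sum_le_sum_abs _ _
    _ ≤ ∑ i ∈ w.support, w i * ε := by
        refine Finset.sum_le_sum fun i hi => ?_
        rw [abs_mul, abs_of_nonneg (h0 i)]
        refine mul_le_mul_of_nonneg_left (h i ?_) (h0 i)
        by_contra hlt
        exact (Finsupp.mem_support_iff.1 hi) (hn i (by omega))
    _ = ε := by rw [← Finset.sum_mul, h1, one_mul]

lemma tendsto_tailSimplex_sum {w : ℕ → ℕ →₀ ℝ} {φ : ℕ → ℕ} (hφ : Tendsto φ atTop atTop)
    (hw : ∀ k, w k ∈ tailSimplex (φ k)) {a : ℕ → ℝ} {l : ℝ} (ha : Tendsto a atTop (𝓝 l)) :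
    Tendsto (fun k => (w k).sum fun i x => x * a i) atTop (𝓝 l) := by
  rw [Metric.tendsto_atTop] at ha ⊢
  intro ε hε
  obtain ⟨N, hN⟩ := ha (ε / 2) (by positivity)
  obtain ⟨K, hK⟩ := (tendsto_atTop_atTop.1 hφ) N
  refine ⟨K, fun k hk => ?_⟩
  rw [Real.dist_eq]
  refine (abs_sum_sub_le (hw k) (ε := ε / 2) fun i hi => ?_).trans_lt (by linarith)
  rw [← Real.dist_eq]
  exact (hN i ((hK k hk).trans hi)).le

/-- The combination of the dyadic integrals of a path with weights `w`. -/
noncomputable def pathCombination (m : ℝ≥0 → ℝ) (w : ℕ →₀ ℝ) (t : ℝ≥0) : ℝ :=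
  w.sum fun i x => x * pathIntegral m i t

lemma pathCombination_zero (m : ℝ≥0 → ℝ) (w : ℕ →₀ ℝ) : pathCombination m w 0 = 0 := by
  simp [pathCombination, pathIntegral_zero]

lemma pathCombination_rightCont {m : ℝ≥0 → ℝ} {t : ℝ≥0}
    (hm : ContinuousWithinAt m (Set.Ici t) t) (w : ℕ →₀ ℝ) :
    ContinuousWithinAt (pathCombination m w) (Set.Ici t) t := by
  unfold pathCombination Finsupp.sum
  exact tendsto_finsetSum _ fun i _ => (pathIntegral_rightCont hm i).const_mul _

lemma tendsto_pathCombination_left {m : ℝ≥0 → ℝ} {t : ℝ≥0} {l : ℝ}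
    (hm : Tendsto m (𝓝[<] t) (𝓝 l)) {k : ℕ → ℕ} (h1 : ∀ i, dyadic i (k i) < t)
    (h2 : ∀ i, t ≤ dyadic i (k i + 1)) (w : ℕ →₀ ℝ) :
    Tendsto (pathCombination m w) (𝓝[<] t) (𝓝 (pathCombination m w t -
      2 * (w.sum fun i x => x * m (dyadic i (k i))) * (m t - l))) := by
  have e : pathCombination m w t - 2 * (w.sum fun i x => x * m (dyadic i (k i))) * (m t - l) =
      w.sum fun i x => x * (pathIntegral m i t - 2 * m (dyadic i (k i)) * (m t - l)) := by
    simp only [pathCombination, Finsupp.sum, Finset.mul_sum, Finset.sum_mul]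
    rw [← Finset.sum_sub_distrib]
    exact Finset.sum_congr rfl fun i _ => by ring
  rw [e]
  unfold pathCombination Finsupp.sum
  exact tendsto_finsetSum _ fun i _ => (tendsto_pathIntegral_left hm (h1 i) (h2 i)).const_mul _

/-- At level `i` the jump at `t` is `2 m(s) Δm(t)`, where `s` is the last grid point strictly before
`t`. As `i → ∞` these points increase the level of approximation to `t` from the left, so `m(s) →
l`, and tail averages keep this limit. Uniform convergence permits the exchange of limits. -/
lemma pathCombination_tendsto_left_limit {m f : ℝ≥0 → ℝ} {t : ℝ≥0} (ht : 0 < t) {l : ℝ}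
    (hm : Tendsto m (𝓝[<] t) (𝓝 l)) {w : ℕ → ℕ →₀ ℝ} {φ : ℕ → ℕ} (hφ : Tendsto φ atTop atTop)
    (hw : ∀ k, w k ∈ tailSimplex (φ k))
    (hf : TendstoUniformly (fun j => pathCombination m (w j)) f atTop) :
    Tendsto f (𝓝[<] t) (𝓝 (f t - 2 * l * (m t - l))) := by
  choose k h1 h2 using fun i => exists_dyadic_lt_le i ht
  have hd : Tendsto (fun i => dyadic i (k i)) atTop (𝓝[<] t) := by
    refine tendsto_nhdsWithin_iff.2 ⟨?_, .of_forall h1⟩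
    have hp : Tendsto (fun i : ℕ => t - (1 / 2 : ℝ≥0) ^ i) atTop (𝓝 t) := by
      have := (tendsto_const_nhds (x := t)).sub
        (NNReal.tendsto_pow_atTop_nhds_zero_of_lt_one (r := 1 / 2) (by
          rw [div_lt_one (by norm_num)]; norm_num))
      simpa using this
    refine tendsto_of_tendsto_of_tendsto_of_le_of_le hp tendsto_const_nhds (fun i => ?_)
      fun i => (h1 i).le
    exact tsub_le_iff_right.2 ((dyadic_succ i (k i)) ▸ h2 i)
  have hl := tendsto_tailSimplex_sum hφ hw (hm.comp hd)
  have hU : TendstoUniformlyOnFilter (fun j => pathCombination m (w j)) f atTop (𝓝[<] t) :=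
    hf.tendstoUniformlyOnFilter.mono_right le_top
  exact hU.tendsto_of_eventually_tendsto
    (.of_forall fun j => tendsto_pathCombination_left hm h1 h2 (w j))
    ((hf.tendsto_at t).sub ((hl.const_mul 2).mul_const _))

lemma pathCombination_limit_rightCont {m f : ℝ≥0 → ℝ} {t : ℝ≥0}
    (hm : ContinuousWithinAt m (Set.Ici t) t) {w : ℕ → ℕ →₀ ℝ}
    (hf : TendstoUniformly (fun j => pathCombination m (w j)) f atTop) :
    ContinuousWithinAt f (Set.Ici t) t := by
  have hU : TendstoUniformlyOnFilter (fun j => pathCombination m (w j)) f atTop (𝓝[≥] t) :=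
    hf.tendstoUniformlyOnFilter.mono_right le_top
  exact hU.tendsto_of_eventually_tendsto
    (.of_forall fun j => pathCombination_rightCont hm (w j)) (hf.tendsto_at t)

lemma exists_dyadic_between {s t : ℝ≥0} (h : s < t) : ∃ n k, s < dyadic n k ∧ dyadic n k < t := by
  obtain ⟨n, hn⟩ := exists_pow_lt_of_lt_one (tsub_pos_of_lt h)
    (show (1 / 2 : ℝ≥0) < 1 by rw [div_lt_one (by norm_num)]; norm_num)
  obtain ⟨k, h1, h2⟩ := exists_dyadic_le_lt n s
  refine ⟨n, k + 1, h2, ?_⟩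
  rw [dyadic_succ]
  calc dyadic n k + (1 / 2) ^ n ≤ s + (1 / 2) ^ n := by gcongr
    _ < s + (t - s) := by gcongr
    _ = t := add_tsub_cancel_of_le h.le

/-- Right-limits along dyadic times. -/
lemma exists_seq_dyadic (t : ℝ≥0) : ∃ n k : ℕ → ℕ,
    Tendsto (fun i => dyadic (n i) (k i)) atTop (𝓝[≥] t) := by
  have h : ∀ i : ℕ, ∃ p : ℕ × ℕ, t < dyadic p.1 p.2 ∧ dyadic p.1 p.2 < t + 1 / ((i : ℝ≥0) + 1) := by
    intro i
    obtain ⟨n, k, h⟩ := exists_dyadic_between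
      (show t < t + 1 / ((i : ℝ≥0) + 1) from lt_add_of_pos_right _ (by positivity))
    exact ⟨(n, k), h⟩
  choose p hp using h
  refine ⟨fun i => (p i).1, fun i => (p i).2, tendsto_nhdsWithin_iff.2
    ⟨?_, .of_forall fun i => (hp i).1.le⟩⟩
  refine tendsto_of_tendsto_of_tendsto_of_le_of_le tendsto_const_nhds
    (h := fun i : ℕ => t + 1 / ((i : ℝ≥0) + 1)) ?_ (fun i => (hp i).1.le) fun i => (hp i).2.le
  have : Tendsto (fun i : ℕ => 1 / ((i : ℝ≥0) + 1)) atTop (𝓝 0) :=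
    tendsto_one_div_add_atTop_nhds_zero_nat
  simpa using this.const_add t

/-- Two dyadic times lie on a common grid; right-continuity does the rest. -/
lemma monotone_of_monotone_dyadic {g : ℝ≥0 → ℝ}
    (hg : ∀ t, ContinuousWithinAt g (Set.Ici t) t)
    (h : ∀ n, Monotone fun k => g (dyadic n k)) : Monotone g := by
  have hd : ∀ {n k n' k'}, dyadic n k ≤ dyadic n' k' → g (dyadic n k) ≤ g (dyadic n' k') := by
    intro n k n' k' hle
    have e1 := dyadic_eq_of_le (le_max_left n n') k
    have e2 := dyadic_eq_of_le (le_max_right n n') k'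
    rw [e1, e2] at hle ⊢
    refine h _ ?_
    unfold dyadic at hle
    rw [div_le_div_iff_of_pos_right (by positivity)] at hle
    exact_mod_cast hle
  intro s t hst
  rcases hst.eq_or_lt with rfl | hlt
  · rfl
  obtain ⟨n, k, hs⟩ := exists_seq_dyadic s
  obtain ⟨n', k', ht⟩ := exists_seq_dyadic t
  refine le_of_tendsto_of_tendsto ((hg s).tendsto.comp hs) ((hg t).tendsto.comp ht) ?_
  filter_upwards [(tendsto_nhdsWithin_iff.1 hs).1.eventually (Iio_mem_nhds hlt),
    (tendsto_nhdsWithin_iff.1 ht).2] with i h1 h2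
  exact hd ((Set.mem_Iio.1 h1).le.trans h2)

/-- Once `φ j ≥ n`, all weights sit on levels `i ≥ n`, whose grids contain the level-`n` grid. -/
lemma monotone_sq_sub_limit {m f : ℝ≥0 → ℝ} (hm : ∀ t, ContinuousWithinAt m (Set.Ici t) t)
    {w : ℕ → ℕ →₀ ℝ} {φ : ℕ → ℕ} (hφ : Tendsto φ atTop atTop)
    (hw : ∀ k, w k ∈ tailSimplex (φ k))
    (hf : TendstoUniformly (fun j => pathCombination m (w j)) f atTop) :
    Monotone fun t => m t ^ 2 - f t := by
  refine monotone_of_monotone_dyadic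
    (fun t => ((hm t).pow 2).sub (pathCombination_limit_rightCont (hm t) hf)) fun n k k' hk => ?_
  refine le_of_tendsto_of_tendsto (tendsto_const_nhds.sub (hf.tendsto_at (dyadic n k)))
    (tendsto_const_nhds.sub (hf.tendsto_at (dyadic n k'))) ?_
  filter_upwards [hφ.eventually_ge_atTop n] with j hj
  have hle : ∀ i ∈ (w j).support, (w j) i * (m (dyadic n k) ^ 2 - pathIntegral m i (dyadic n k)) ≤
      (w j) i * (m (dyadic n k') ^ 2 - pathIntegral m i (dyadic n k')) := by
    intro i hi
    refine mul_le_mul_of_nonneg_left ?_ ((hw j).1 i)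
    have hni : n ≤ i := by
      by_contra hlt
      exact (Finsupp.mem_support_iff.1 hi) ((hw j).2.1 i (by omega))
    rw [dyadic_eq_of_le hni k, dyadic_eq_of_le hni k']
    exact monotone_sq_sub_pathIntegral m i (Nat.mul_le_mul_right _ hk)
  have := Finset.sum_le_sum hle
  simp_rw [mul_sub, Finset.sum_sub_distrib, ← Finset.sum_mul] at this
  have h1 := (hw j).2.2
  simp only [Finsupp.sum] at h1
  rw [h1] at this
  simpa [pathCombination, Finsupp.sum] using this

lemma IsCadlag.sq_sub_limit {m f : ℝ≥0 → ℝ} (hm : IsCadlag m)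
    {w : ℕ → ℕ →₀ ℝ} {φ : ℕ → ℕ} (hφ : Tendsto φ atTop atTop)
    (hw : ∀ k, w k ∈ tailSimplex (φ k))
    (hf : TendstoUniformly (fun j => pathCombination m (w j)) f atTop) :
    IsCadlag fun t => m t ^ 2 - f t := by
  intro t
  refine ⟨((hm t).1.pow 2).sub (pathCombination_limit_rightCont (hm t).1 hf), ?_⟩
  rcases eq_zero_or_pos t with rfl | ht
  -- The filter `𝓝[<] 0` is trivial, so any value is a left limit.
  · exact ⟨0, by simp⟩
  · obtain ⟨l, hl⟩ := (hm t).2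
    exact ⟨_, (hl.pow 2).sub (pathCombination_tendsto_left_limit ht hl hφ hw hf)⟩

lemma jump_zero (f : ℝ≥0 → ℝ) : jump f 0 = 0 := by
  rw [jump, leftLim_eq_of_eq_bot _ (by simp), sub_self]

lemma jump_eq {f : ℝ≥0 → ℝ} {t : ℝ≥0} (ht : 0 < t) {l : ℝ} (h : Tendsto f (𝓝[<] t) (𝓝 l)) :
    jump f t = f t - l := by
  have : (𝓝[<] t).NeBot := nhdsLT_neBot_of_exists_lt ⟨0, ht⟩
  rw [jump, leftLim_eq_of_tendsto h]

lemma jump_sq_sub_limit {m f : ℝ≥0 → ℝ} (hm : IsCadlag m)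
    {w : ℕ → ℕ →₀ ℝ} {φ : ℕ → ℕ} (hφ : Tendsto φ atTop atTop)
    (hw : ∀ k, w k ∈ tailSimplex (φ k))
    (hf : TendstoUniformly (fun j => pathCombination m (w j)) f atTop) (t : ℝ≥0) :
    jump (fun t => m t ^ 2 - f t) t = jump m t ^ 2 := by
  rcases eq_zero_or_pos t with rfl | ht
  · simp [jump_zero]
  · obtain ⟨l, hl⟩ := (hm t).2
    rw [jump_eq ht hl,
      jump_eq ht ((hl.pow 2).sub (pathCombination_tendsto_left_limit ht hl hφ hw hf))]
    ring

/-! ### Orthogonality of martingale increments -/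

section Martingale

variable {Ω ι : Type*} {mΩ : MeasurableSpace Ω} [Preorder ι] {P : Measure Ω}
  {ℱ : Filtration ι mΩ} {X : ι → Ω → ℝ}

lemma condExp_mul_sub (hX : Martingale X ℱ P) {s t : ι} (hst : s ≤ t) {g : Ω → ℝ}
    (hg : StronglyMeasurable[ℱ s] g) (hs : Integrable (g * X s) P) (ht : Integrable (g * X t) P) :
    P[g * (X t - X s) | ℱ s] =ᵐ[P] 0 := by
  have hi : Integrable (g * (X t - X s)) P := by
    rw [mul_sub]; exact ht.sub hs
  refine (condExp_mul_of_stronglyMeasurable_left hg hi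
    ((hX.integrable t).sub (hX.integrable s))).trans ?_
  have h1 := condExp_sub (hX.integrable t) (hX.integrable s) (ℱ s)
  filter_upwards [h1, hX.2 s t hst, hX.2 s s le_rfl] with ω h1 h2 h3
  simp [h1, h2, h3]

variable [IsProbabilityMeasure P]

lemma integral_mul_sub (hX : Martingale X ℱ P) {s t : ι} (hst : s ≤ t) {g : Ω → ℝ}
    (hg : StronglyMeasurable[ℱ s] g) (hs : Integrable (g * X s) P) (ht : Integrable (g * X t) P) :
    ∫ ω, g ω * (X t ω - X s ω) ∂P = 0 := by
  have h := integral_condExp (μ := P) (f := g * (X t - X s)) (ℱ.le s)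
  rw [integral_congr_ae (condExp_mul_sub hX hst hg hs ht)] at h
  simpa using h.symm

/-- Orthogonality of martingale increments. -/
lemma integral_sq_sub (hX : Martingale X ℱ P) {s t : ι} (hst : s ≤ t) (hs : MemLp (X s) 2 P)
    (ht : MemLp (X t) 2 P) :
    ∫ ω, (X t ω - X s ω) ^ 2 ∂P = ∫ ω, X t ω ^ 2 ∂P - ∫ ω, X s ω ^ 2 ∂P := by
  have h0 := integral_mul_sub hX hst (hX.1 s) (hs.integrable_mul hs) (hs.integrable_mul ht)
  have hi : Integrable (fun ω => X s ω * (X t ω - X s ω)) P := hs.integrable_mul (ht.sub hs)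
  have e : ∀ ω, (X t ω - X s ω) ^ 2 = X t ω ^ 2 - X s ω ^ 2 - 2 * (X s ω * (X t ω - X s ω)) :=
    fun ω => by ring
  simp_rw [e]
  have hts : Integrable (fun ω => X t ω ^ 2 - X s ω ^ 2) P :=
    ht.integrable_sq.sub hs.integrable_sq
  rw [integral_sub hts (hi.const_mul 2), integral_sub ht.integrable_sq hs.integrable_sq, integral_const_mul, h0]
  simp

lemma integral_sq_mono (hX : Martingale X ℱ P) {s t : ι} (hst : s ≤ t) (hs : MemLp (X s) 2 P)
    (ht : MemLp (X t) 2 P) : ∫ ω, X s ω ^ 2 ∂P ≤ ∫ ω, X t ω ^ 2 ∂P := by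
  have := integral_sq_sub hX hst hs ht
  have h0 : 0 ≤ ∫ ω, (X t ω - X s ω) ^ 2 ∂P := integral_nonneg fun ω => sq_nonneg _
  linarith

lemma memLp_of_bounded {m : MeasurableSpace Ω} (hm : m ≤ mΩ) {f : Ω → ℝ}
    (hf : StronglyMeasurable[m] f) (hb : ∃ C, ∀ ω, |f ω| ≤ C) (p : ℝ≥0∞) : MemLp f p P := by
  obtain ⟨C, hC⟩ := hb
  exact MemLp.of_bound (hf.mono hm).aestronglyMeasurable C (.of_forall hC)

end Martingale

/-! ### Discrete stochastic integrals of bounded martingales -/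

section Discrete

variable {Ω : Type*} {mΩ : MeasurableSpace Ω} {P : Measure Ω}
  [IsProbabilityMeasure P] {𝒢 : Filtration ℕ mΩ} {x : ℕ → Ω → ℝ}

lemma integral_sum_sq_sub (hx : Martingale x 𝒢 P) (h2 : ∀ k, MemLp (x k) 2 P) (n : ℕ) :
    ∫ ω, ∑ k ∈ Finset.range n, (x (k + 1) ω - x k ω) ^ 2 ∂P =
      ∫ ω, x n ω ^ 2 ∂P - ∫ ω, x 0 ω ^ 2 ∂P := by
  have hi : ∀ k, Integrable (fun ω => (x (k + 1) ω - x k ω) ^ 2) P :=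
    fun k => ((h2 (k + 1)).sub (h2 k)).integrable_sq
  rw [integral_finsetSum _ fun k _ => hi k]
  simp_rw [fun k => integral_sq_sub hx (Nat.le_succ k) (h2 k) (h2 (k + 1))]
  exact Finset.sum_range_sub (fun k => ∫ ω, x k ω ^ 2 ∂P) n

/-- The discrete stochastic integral of `x` against itself. -/
def selfIntegral (x : ℕ → Ω → ℝ) (n : ℕ) (ω : Ω) : ℝ :=
  ∑ k ∈ Finset.range n, x k ω * (x (k + 1) ω - x k ω)

lemma selfIntegral_bounded {c : ℝ} (hc : ∀ k ω, |x k ω| ≤ c) (n : ℕ) :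
    ∃ C, ∀ ω, |selfIntegral x n ω| ≤ C := by
  refine ⟨∑ _k ∈ Finset.range n, c * (c + c), fun ω => ?_⟩
  refine (Finset.abs_sum_le_sum_abs _ _).trans (Finset.sum_le_sum fun k _ => ?_)
  rw [abs_mul]
  exact mul_le_mul (hc k ω) ((abs_sub _ _).trans (add_le_add (hc _ ω) (hc _ ω))) (abs_nonneg _)
    ((abs_nonneg _).trans (hc k ω))

lemma selfIntegral_stronglyMeasurable (hx : StronglyAdapted 𝒢 x) (n : ℕ) :
    StronglyMeasurable[𝒢 n] (selfIntegral x n) := by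
  unfold selfIntegral
  refine Finset.stronglyMeasurable_fun_sum _ fun k hk => ?_
  have hk : k < n := by simpa using hk
  have h1 := (hx k).mono (𝒢.mono hk.le)
  have h2 := (hx (k + 1)).mono (𝒢.mono (Nat.succ_le_of_lt hk))
  exact h1.mul (h2.sub h1)

/-- The summands are orthogonal and `x k ^ 2 ≤ c ^ 2`, so the second moment is at most `c²` times
the expected sum of squared increments. That sum telescopes and is again at most `c²`, whatever the
number of steps. -/
lemma integral_selfIntegral_sq_le (hx : Martingale x 𝒢 P) {c : ℝ} (hc : ∀ k ω, |x k ω| ≤ c)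
    (n : ℕ) : ∫ ω, selfIntegral x n ω ^ 2 ∂P ≤ c ^ 4 := by
  have hb : ∀ k, MemLp (x k) 2 P := fun k => memLp_of_bounded (𝒢.le k) (hx.1 k) ⟨c, hc k⟩ 2
  have key : ∀ n, ∫ ω, selfIntegral x n ω ^ 2 ∂P ≤
      c ^ 2 * (∫ ω, x n ω ^ 2 ∂P - ∫ ω, x 0 ω ^ 2 ∂P) := by
    intro n
    induction n with
    | zero => simp [selfIntegral]
    | succ n ih =>
      have hS := selfIntegral_stronglyMeasurable hx.1 n
      obtain ⟨C, hC⟩ := selfIntegral_bounded hc n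
      have hSx : MemLp (fun ω => selfIntegral x n ω * x n ω) 2 P :=
        memLp_of_bounded (𝒢.le n) (hS.mul (hx.1 n)) ⟨C * c, fun ω => by
          rw [Pi.mul_apply, abs_mul]
          exact mul_le_mul (hC ω) (hc n ω) (abs_nonneg _) ((abs_nonneg _).trans (hC ω))⟩ 2
      have h0 := integral_mul_sub hx n.le_succ (hS.mul (hx.1 n))
        (hSx.integrable_mul (hb n)) (hSx.integrable_mul (hb (n + 1)))
      have hd : MemLp (fun ω => x (n + 1) ω - x n ω) 2 P := (hb (n + 1)).sub (hb n)
      have hS2 : Integrable (fun ω => selfIntegral x n ω ^ 2) P :=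
        (memLp_of_bounded (𝒢.le n) hS ⟨C, hC⟩ 2).integrable_sq
      have hi : Integrable (fun ω => selfIntegral x n ω * x n ω * (x (n + 1) ω - x n ω)) P :=
        hSx.integrable_mul hd
      have hdi : Integrable (fun ω => c ^ 2 * (x (n + 1) ω - x n ω) ^ 2) P :=
        hd.integrable_sq.const_mul _
      calc ∫ ω, selfIntegral x (n + 1) ω ^ 2 ∂P
          ≤ ∫ ω, (selfIntegral x n ω ^ 2 +
            2 * (selfIntegral x n ω * x n ω * (x (n + 1) ω - x n ω)) +
            c ^ 2 * (x (n + 1) ω - x n ω) ^ 2) ∂P := by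
            refine integral_mono_of_nonneg (.of_forall fun ω => sq_nonneg _)
              ((hS2.add (hi.const_mul 2)).add hdi) (.of_forall fun ω => ?_)
            have e : selfIntegral x (n + 1) ω = selfIntegral x n ω +
                x n ω * (x (n + 1) ω - x n ω) := by
              simp [selfIntegral, Finset.sum_range_succ]
            have hsq : x n ω ^ 2 ≤ c ^ 2 := sq_le_sq' (abs_le.1 (hc n ω)).1 (abs_le.1 (hc n ω)).2
            have := mul_le_mul_of_nonneg_right hsq (sq_nonneg (x (n + 1) ω - x n ω))
            simp only [e]
            nlinarith
        _ = ∫ ω, selfIntegral x n ω ^ 2 ∂P + c ^ 2 * ∫ ω, (x (n + 1) ω - x n ω) ^ 2 ∂P := by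
            have hSi : Integrable (fun ω => selfIntegral x n ω ^ 2 +
                2 * (selfIntegral x n ω * x n ω * (x (n + 1) ω - x n ω))) P :=
              hS2.add (hi.const_mul 2)
            rw [integral_add hSi hdi,
              integral_add hS2 (hi.const_mul 2), integral_const_mul, integral_const_mul]
            have h0' : ∫ ω, selfIntegral x n ω * x n ω * (x (n + 1) ω - x n ω) ∂P = 0 := h0
            rw [h0']; ring
        _ ≤ _ := by
            rw [integral_sq_sub hx n.le_succ (hb n) (hb (n + 1))]
            linarith
  refine (key n).trans ?_
  have h1 : ∫ ω, x n ω ^ 2 ∂P ≤ c ^ 2 := by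
    have := integral_mono (μ := P) (hb n).integrable_sq (integrable_const (c ^ 2))
      fun ω => sq_le_sq' (abs_le.1 (hc n ω)).1 (abs_le.1 (hc n ω)).2
    simpa using this
  have h2 : 0 ≤ ∫ ω, x 0 ω ^ 2 ∂P := integral_nonneg fun ω => sq_nonneg _
  nlinarith [sq_nonneg c]

end Discrete

/-! ### The dyadic integrals as martingales in continuous time -/

section Continuous

variable {Ω : Type*} {mΩ : MeasurableSpace Ω} {P : Measure Ω}
  {ℱ : Filtration ℝ≥0 mΩ} {M : ℝ≥0 → Ω → ℝ}

/-- The filtration sampled along a monotone sequence of times. -/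
def sampledFiltration (ℱ : Filtration ℝ≥0 mΩ) (τ : ℕ → ℝ≥0) (hτ : Monotone τ) :
    Filtration ℕ mΩ where
  seq k := ℱ (τ k)
  mono' _ _ h := ℱ.mono (hτ h)
  le' k := ℱ.le (τ k)

lemma Martingale.sampled (hM : Martingale M ℱ P) {τ : ℕ → ℝ≥0} (hτ : Monotone τ) :
    Martingale (fun k => M (τ k)) (sampledFiltration ℱ τ hτ) P :=
  ⟨fun k => hM.1 (τ k), fun i j h => hM.2 (τ i) (τ j) (hτ h)⟩

lemma martingale_finset_sum {ι κ : Type*} [Preorder ι] {𝒢 : Filtration ι mΩ} (s : Finset κ)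
    {Z : κ → ι → Ω → ℝ} (hZ : ∀ k ∈ s, Martingale (Z k) 𝒢 P) :
    Martingale (fun t => ∑ k ∈ s, Z k t) 𝒢 P := by
  classical
  induction s using Finset.induction_on with
  | empty => exact martingale_zero ℝ 𝒢 P
  | insert a s ha ih =>
    simp_rw [Finset.sum_insert ha]
    exact (hZ a (Finset.mem_insert_self a s)).add
      (ih fun k hk => hZ k (Finset.mem_insert_of_mem hk))

variable [IsProbabilityMeasure P]

lemma stronglyMeasurable_min (hM : StronglyAdapted ℱ M) (t b : ℝ≥0) :
    StronglyMeasurable[ℱ t] (M (min t b)) :=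
  (hM (min t b)).mono (ℱ.mono (min_le_left t b))

lemma martingale_stopped_const (hM : Martingale M ℱ P) (b : ℝ≥0) :
    Martingale (fun t => M (min t b)) ℱ P := by
  refine ⟨fun t => stronglyMeasurable_min hM.1 t b, fun s t hst => ?_⟩
  rcases le_total s b with h | h
  · simp only [min_eq_left h]
    exact hM.2 s _ (le_min hst h)
  · simp only [min_eq_right h, min_eq_right (h.trans hst)]
    rw [condExp_of_stronglyMeasurable (ℱ.le s) ((hM.1 b).mono (ℱ.mono h)) (hM.integrable b)]

/-- The process vanishes up to time `a`; afterwards it is the `ℱ a`-measurable factor `M a` times a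
martingale increment. For `s ≤ a ≤ t` the tower property is applied through `ℱ a`. -/
lemma martingale_mul_sub (hM : Martingale M ℱ P) {c : ℝ} (hc : ∀ t ω, |M t ω| ≤ c)
    {a b : ℝ≥0} (hab : a ≤ b) :
    Martingale (fun t => M (min t a) * (M (min t b) - M (min t a))) ℱ P := by
  have hL : ∀ t, MemLp (M t) 2 P := fun t => memLp_of_bounded (ℱ.le t) (hM.1 t) ⟨c, hc t⟩ 2
  have hmart : ∀ s t, a ≤ s → s ≤ t →
      P[M (min t a) * (M (min t b) - M (min t a)) | ℱ s] =ᵐ[P]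
        M (min s a) * (M (min s b) - M (min s a)) := by
    intro s t has hst
    rw [min_eq_right has, min_eq_right (has.trans hst)]
    have h0 := condExp_mul_sub (martingale_stopped_const hM b) hst ((hM.1 a).mono (ℱ.mono has))
      ((hL a).integrable_mul (hL _)) ((hL a).integrable_mul (hL _))
    have hZ : StronglyMeasurable[ℱ s] (M a * (M (min s b) - M a)) :=
      ((hM.1 a).mono (ℱ.mono has)).mul
        ((stronglyMeasurable_min hM.1 s b).sub ((hM.1 a).mono (ℱ.mono has)))
    have hZi : Integrable (M a * (M (min s b) - M a)) P :=
      (hL a).integrable_mul ((hL _).sub (hL a))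
    have hDi : Integrable (M a * (M (min t b) - M (min s b))) P :=
      (hL a).integrable_mul ((hL _).sub (hL _))
    have e : M a * (M (min t b) - M a) =
        M a * (M (min t b) - M (min s b)) + M a * (M (min s b) - M a) := by ring
    rw [e]
    refine (condExp_add hDi hZi (ℱ s)).trans ?_
    rw [condExp_of_stronglyMeasurable (ℱ.le s) hZ hZi]
    filter_upwards [h0] with ω h
    simp [h]
  refine ⟨fun t => (stronglyMeasurable_min hM.1 t a).mul
    ((stronglyMeasurable_min hM.1 t b).sub (stronglyMeasurable_min hM.1 t a)), fun s t hst => ?_⟩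
  rcases le_total a s with has | hsa
  · exact hmart s t has hst
  · have es : M (min s a) * (M (min s b) - M (min s a)) = 0 := by
      rw [min_eq_left hsa, min_eq_left (hsa.trans hab), sub_self, mul_zero]
    simp only [es]
    rcases le_total t a with hta | hat
    · rw [min_eq_left hta, min_eq_left (hta.trans hab), sub_self, mul_zero, condExp_zero]
    · have h := hmart a t le_rfl hat
      rw [min_self, min_eq_left hab, sub_self, mul_zero] at h
      refine (condExp_condExp_of_le (ℱ.mono hsa) (ℱ.le a)).symm.trans ?_
      refine (condExp_congr_ae h).trans ?_
      rw [condExp_zero]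

lemma dyadicIntegral_eq_pathIntegral (n : ℕ) (t : ℝ≥0) (ω : Ω) :
    dyadicIntegral M n t ω = pathIntegral (fun s => M s ω) n t := rfl

lemma dyadicIntegral_eq_sum {n K : ℕ} {t : ℝ≥0} (h : t ≤ dyadic n K) :
    dyadicIntegral M n t = (2 : ℝ) • ∑ k ∈ Finset.range K, M (min t (dyadic n k)) *
      (M (min t (dyadic n (k + 1))) - M (min t (dyadic n k))) := by
  ext ω
  rw [dyadicIntegral_eq_pathIntegral, pathIntegral_eq_sum _ h]
  simp [Finset.sum_apply]

lemma martingale_dyadicIntegral (hM : Martingale M ℱ P) {c : ℝ} (hc : ∀ t ω, |M t ω| ≤ c)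
    (n : ℕ) : Martingale (dyadicIntegral M n) ℱ P := by
  have hZ : ∀ K, Martingale (fun t => (2 : ℝ) • ∑ k ∈ Finset.range K, M (min t (dyadic n k)) *
      (M (min t (dyadic n (k + 1))) - M (min t (dyadic n k)))) ℱ P := fun K =>
    (martingale_finset_sum _ fun k _ =>
      martingale_mul_sub hM hc (monotone_dyadic n k.le_succ)).smul 2
  refine ⟨fun t => ?_, fun s t hst => ?_⟩
  · obtain ⟨K, hK⟩ := exists_le_dyadic n t
    rw [dyadicIntegral_eq_sum hK]
    exact (hZ K).1 t
  · obtain ⟨K, hK⟩ := exists_le_dyadic n t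
    rw [dyadicIntegral_eq_sum hK, dyadicIntegral_eq_sum (hst.trans hK)]
    exact (hZ K).2 s t hst

lemma dyadicIntegral_eq_selfIntegral {n K : ℕ} {t : ℝ≥0} (h : t ≤ dyadic n K) (ω : Ω) :
    dyadicIntegral M n t ω = 2 * selfIntegral (fun k => M (min t (dyadic n k))) K ω :=
  pathIntegral_eq_sum (fun s => M s ω) h

lemma dyadicIntegral_bounded {c : ℝ} (hc : ∀ t ω, |M t ω| ≤ c) (n : ℕ) (t : ℝ≥0) :
    ∃ C, ∀ ω, |dyadicIntegral M n t ω| ≤ C := by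
  obtain ⟨K, hK⟩ := exists_le_dyadic n t
  obtain ⟨C, hC⟩ := selfIntegral_bounded (x := fun k => M (min t (dyadic n k)))
    (fun k ω => hc _ ω) K
  refine ⟨2 * C, fun ω => ?_⟩
  rw [dyadicIntegral_eq_selfIntegral hK, abs_mul, abs_two]
  exact mul_le_mul_of_nonneg_left (hC ω) zero_le_two

lemma integral_dyadicIntegral_sq_le (hM : Martingale M ℱ P) {c : ℝ} (hc : ∀ t ω, |M t ω| ≤ c)
    (n : ℕ) (t : ℝ≥0) : ∫ ω, dyadicIntegral M n t ω ^ 2 ∂P ≤ 4 * c ^ 4 := by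
  obtain ⟨K, hK⟩ := exists_le_dyadic n t
  have hτ : Monotone fun k => min t (dyadic n k) := fun a b h =>
    min_le_min le_rfl (monotone_dyadic n h)
  have := integral_selfIntegral_sq_le (Martingale.sampled hM hτ) (fun k ω => hc _ ω) K
  simp_rw [dyadicIntegral_eq_selfIntegral hK, mul_pow]
  rw [integral_const_mul]
  linarith

end Continuous

/-! ### Cauchy combinations and almost sure uniform convergence -/

section

lemma tailSimplex_antitone : Antitone tailSimplex := fun _ _ h _ hw =>
  ⟨hw.1, fun i hi => hw.2.1 i (hi.trans_le h), hw.2.2⟩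

lemma single_mem_tailSimplex (n : ℕ) : Finsupp.single n 1 ∈ tailSimplex n := by
  refine ⟨fun i => ?_, fun i hi => ?_, by simp⟩
  · by_cases h : n = i <;> simp [h]
  · simp [hi.ne']

lemma midpoint_mem_tailSimplex {n : ℕ} {v w : ℕ →₀ ℝ} (hv : v ∈ tailSimplex n)
    (hw : w ∈ tailSimplex n) : (1 / 2 : ℝ) • (v + w) ∈ tailSimplex n := by
  refine ⟨fun i => ?_, fun i hi => ?_, ?_⟩
  · simp only [Finsupp.smul_apply, Finsupp.add_apply, smul_eq_mul]
    linarith [hv.1 i, hw.1 i]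
  · simp [hv.2.1 i hi, hw.2.1 i hi]
  · rw [Finsupp.sum_smul_index (by simp), ← Finsupp.mul_sum,
      Finsupp.sum_add_index' (by simp) (by simp), hv.2.2, hw.2.2]
    norm_num

/-- Minimizing a bounded quadratic functional over tail convex combinations yields a Cauchy
sequence. -/
lemma exists_cauchy_weights (q : (ℕ →₀ ℝ) → ℝ) (h0 : ∀ w, 0 ≤ q w)
    (hpar : ∀ v w, q (v + w) + q (v - w) = 2 * q v + 2 * q w)
    {C : ℝ} (hC : ∀ n, q (Finsupp.single n 1) ≤ C) :
    ∃ y : ℕ → ℕ →₀ ℝ, (∀ n, y n ∈ tailSimplex n) ∧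
      ∀ ε > 0, ∃ N, ∀ n ≥ N, ∀ m ≥ N, q (y n - y m) ≤ ε := by
  have hq0 : q 0 = 0 := by
    have := hpar 0 0
    simp only [add_zero, sub_zero] at this
    linarith
  have hquad : ∀ v, q ((2 : ℝ) • v) = 4 * q v := fun v => by
    have := hpar v v
    rw [sub_self, hq0, ← two_smul ℝ v] at this
    linarith
  set a : ℕ → ℝ := fun n => sInf (q '' tailSimplex n) with ha
  have hbdd : ∀ n, BddBelow (q '' tailSimplex n) := fun n => ⟨0, by
    rintro _ ⟨w, -, rfl⟩
    exact h0 w⟩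
  have hne : ∀ n, (q '' tailSimplex n).Nonempty := fun n => ⟨_, _, single_mem_tailSimplex n, rfl⟩
  have hmono : Monotone a := fun n m h =>
    csInf_le_csInf (hbdd n) (hne m) (Set.image_mono (tailSimplex_antitone h))
  have hle : ∀ n w, w ∈ tailSimplex n → a n ≤ q w := fun n w hw =>
    csInf_le (hbdd n) ⟨w, hw, rfl⟩
  have haC : BddAbove (Set.range a) := ⟨C, by
    rintro _ ⟨n, rfl⟩
    exact (hle n _ (single_mem_tailSimplex n)).trans (hC n)⟩
  have hex : ∀ n : ℕ, ∃ w ∈ tailSimplex n, q w < a n + 1 / ((n : ℝ) + 1) := fun n => by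
    obtain ⟨_, ⟨w, hw, rfl⟩, h⟩ := exists_lt_of_csInf_lt (hne n)
      (show a n < a n + 1 / ((n : ℝ) + 1) from lt_add_of_pos_right _ (by positivity))
    exact ⟨w, hw, h⟩
  choose y hy hqy using hex
  refine ⟨y, hy, fun ε hε => ?_⟩
  have hlim := tendsto_atTop_ciSup hmono haC
  -- For `n, m ≥ N` the parallelogram law gives `q (y n - y m) = 2 q (y n) + 2 q (y m) - 4 q
  -- (midpoint)`. The midpoint lies in the tail simplex of `N`, so its `q` is at least `a N`; this
  -- expression is the resulting bound.
  have ht : Tendsto (fun N : ℕ => 4 * ((⨆ n, a n) + 1 / ((N : ℝ) + 1)) - 4 * a N) atTop (𝓝 0) := by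
    have := (((tendsto_one_div_add_atTop_nhds_zero_nat (𝕜 := ℝ)).const_add
      (⨆ n, a n)).const_mul 4).sub (hlim.const_mul 4)
    simpa using this
  obtain ⟨N, hN⟩ := (ht.eventually (gt_mem_nhds hε)).exists
  have hup : ∀ n ≥ N, q (y n) ≤ (⨆ n, a n) + 1 / ((N : ℝ) + 1) := fun n hn => by
    refine (hqy n).le.trans (add_le_add (le_ciSup haC n) ?_)
    have : (N : ℝ) ≤ n := by exact_mod_cast hn
    gcongr
  refine ⟨N, fun n hn m hm => ?_⟩
  have hmid := hle N _ (midpoint_mem_tailSimplex (tailSimplex_antitone hn (hy n))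
    (tailSimplex_antitone hm (hy m)))
  have h4 := hquad ((1 / 2 : ℝ) • (y n + y m))
  rw [smul_smul] at h4
  norm_num at h4
  norm_num at hmid
  have := hpar (y n) (y m)
  have h1 := hup n hn
  have h2 := hup m hm
  linarith

variable {Ω : Type*} {mΩ : MeasurableSpace Ω} {P : Measure Ω}
  {ℱ : Filtration ℝ≥0 mΩ} {M : ℝ≥0 → Ω → ℝ}

/-- The linear combination of dyadic integrals with weights `w`. -/
noncomputable def combination (M : ℝ≥0 → Ω → ℝ) (w : ℕ →₀ ℝ) (t : ℝ≥0) (ω : Ω) : ℝ :=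
  pathCombination (fun s => M s ω) w t

lemma combination_eq (M : ℝ≥0 → Ω → ℝ) (w : ℕ →₀ ℝ) (t : ℝ≥0) :
    combination M w t = ∑ i ∈ w.support, w i • dyadicIntegral M i t := by
  ext ω
  simp [combination, pathCombination, Finsupp.sum, Finset.sum_apply, dyadicIntegral_eq_pathIntegral]

lemma combination_add (M : ℝ≥0 → Ω → ℝ) (v w : ℕ →₀ ℝ) (t : ℝ≥0) (ω : Ω) :
    combination M (v + w) t ω = combination M v t ω + combination M w t ω := by
  unfold combination pathCombination
  exact Finsupp.sum_add_index' (by simp) (by intros; ring)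

lemma combination_sub (M : ℝ≥0 → Ω → ℝ) (v w : ℕ →₀ ℝ) (t : ℝ≥0) (ω : Ω) :
    combination M (v - w) t ω = combination M v t ω - combination M w t ω := by
  unfold combination pathCombination
  exact Finsupp.sum_sub_index (by intros; ring)

lemma combination_single (M : ℝ≥0 → Ω → ℝ) (n : ℕ) (t : ℝ≥0) (ω : Ω) :
    combination M (Finsupp.single n 1) t ω = dyadicIntegral M n t ω := by
  simp [combination, pathCombination, dyadicIntegral_eq_pathIntegral]

lemma submartingale_abs {ι : Type*} [Preorder ι] {𝒢 : Filtration ι mΩ} {x : ι → Ω → ℝ}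
    (hx : Martingale x 𝒢 P) : Submartingale (fun k ω => |x k ω|) 𝒢 P :=
  hx.submartingale.sup hx.neg.submartingale

/-- Doob's inequality on the level-`n` grid of `[0, n]`, with `n → ∞`. By right-continuity a strict
exceedance at any time is already seen at a nearby dyadic time. -/
lemma measure_exists_lt_abs_le [IsFiniteMeasure P] {X : ℝ≥0 → Ω → ℝ} (hX : Martingale X ℱ P)
    (hr : ∀ ω t, ContinuousWithinAt (fun s => X s ω) (Set.Ici t) t) {δ : ℝ}
    (hδ : ∀ t, ∫ ω, |X t ω| ∂P ≤ δ) (ε : ℝ≥0) :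
    ε * P {ω | ∃ t, (ε : ℝ) < |X t ω|} ≤ ENNReal.ofReal δ := by
  set S : ℕ → Set Ω := fun n => {ω | ∃ k ≤ n * 2 ^ n, (ε : ℝ) ≤ |X (dyadic n k) ω|} with hS
  have hmem : ∀ {n n' k : ℕ} {ω : Ω}, n ≤ n' → k * 2 ^ (n' - n) ≤ n' * 2 ^ n' →
      (ε : ℝ) ≤ |X (dyadic n k) ω| → ω ∈ S n' := fun {n n' k ω} hn hk h =>
    ⟨k * 2 ^ (n' - n), hk, by rwa [← dyadic_eq_of_le hn]⟩
  have hmono : Monotone S := by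
    rintro n n' hn ω ⟨k, hk, h⟩
    refine hmem hn ?_ h
    calc k * 2 ^ (n' - n) ≤ n * 2 ^ n * 2 ^ (n' - n) := Nat.mul_le_mul_right _ hk
      _ = n * 2 ^ n' := by rw [mul_assoc, ← pow_add, Nat.add_sub_cancel' hn]
      _ ≤ n' * 2 ^ n' := Nat.mul_le_mul_right _ hn
  have hsub : {ω | ∃ t, (ε : ℝ) < |X t ω|} ⊆ ⋃ n, S n := by
    rintro ω ⟨t, ht⟩
    obtain ⟨n, k, h⟩ := exists_seq_dyadic t
    obtain ⟨i, hi⟩ := (((hr ω t).tendsto.comp h).abs.eventually (lt_mem_nhds ht)).exists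
    -- The level must refine level `n i`, and its horizon must exceed the dyadic time, for which `k
    -- i` suffices.
    refine Set.mem_iUnion.2 ⟨max (n i) (k i), hmem (le_max_left _ _) ?_ (le_of_lt hi)⟩
    exact Nat.mul_le_mul (le_max_right _ _) (Nat.pow_le_pow_right two_pos (Nat.sub_le _ _))
  have hSn : ∀ n, ε * P (S n) ≤ ENNReal.ofReal δ := fun n => by
    have hx := Martingale.sampled hX (monotone_dyadic n)
    have hmax := maximal_ineq (submartingale_abs hx) (fun _ _ => abs_nonneg _) (ε := ε) (n * 2 ^ n)
    have e : {ω | (ε : ℝ) ≤ (Finset.range (n * 2 ^ n + 1)).sup' Finset.nonempty_range_add_one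
        fun k => |X (dyadic n k) ω|} = S n := by
      ext ω
      simp [hS, Finset.le_sup'_iff]
    rw [e] at hmax
    refine hmax.trans (ENNReal.ofReal_le_ofReal (le_trans ?_ (hδ (dyadic n (n * 2 ^ n)))))
    exact setIntegral_le_integral (hX.integrable _).abs (.of_forall fun _ => abs_nonneg _)
  calc ε * P {ω | ∃ t, (ε : ℝ) < |X t ω|} ≤ ε * P (⋃ n, S n) := by gcongr
    _ = ⨆ n, ε * P (S n) := by rw [hmono.measure_iUnion, ENNReal.mul_iSup]
    _ ≤ _ := iSup_le hSn

lemma exists_tendstoUniformly_of_geometric {α : Type*} {u : ℕ → α → ℝ}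
    (h : ∀ᶠ k in atTop, ∀ t, |u (k + 1) t - u k t| ≤ (1 / 2) ^ k) :
    ∃ f, TendstoUniformly u f atTop := by
  obtain ⟨K, hK⟩ := eventually_atTop.1 h
  have hd : ∀ t n, dist (u (n + K) t) (u (n + 1 + K) t) ≤ (1 / 2) ^ K * (1 / 2) ^ n := by
    intro t n
    rw [dist_comm, Real.dist_eq, ← pow_add, add_right_comm, add_comm K n]
    exact hK (n + K) (by omega) t
  choose f hf using fun t => cauchySeq_tendsto_of_complete
    (cauchySeq_of_le_geometric (1 / 2 : ℝ) ((1 / 2) ^ K) (by norm_num) (hd t))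
  refine ⟨f, ?_⟩
  rw [Metric.tendstoUniformly_iff]
  intro ε hε
  have ht : Tendsto (fun n : ℕ => (1 / 2 : ℝ) ^ K * (1 / 2) ^ n / (1 - 1 / 2)) atTop (𝓝 0) := by
    have := ((tendsto_pow_atTop_nhds_zero_of_lt_one (r := (1 / 2 : ℝ)) (by norm_num)
      (by norm_num)).const_mul ((1 / 2 : ℝ) ^ K)).div_const (1 - 1 / 2)
    simpa using this
  have hev := ht.eventually (gt_mem_nhds hε)
  rw [← map_add_atTop_eq_nat K, eventually_map]
  filter_upwards [hev] with n hn t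
  rw [dist_comm]
  exact (dist_le_of_le_geometric_of_tendsto (1 / 2 : ℝ) ((1 / 2) ^ K) (by norm_num) (hd t)
    (hf t) n).trans_lt hn

variable [IsProbabilityMeasure P]

lemma martingale_combination (hM : Martingale M ℱ P) {c : ℝ} (hc : ∀ t ω, |M t ω| ≤ c)
    (w : ℕ →₀ ℝ) : Martingale (combination M w) ℱ P := by
  have : combination M w = fun t => ∑ i ∈ w.support, w i • dyadicIntegral M i t :=
    funext (combination_eq M w)
  rw [this]
  exact martingale_finset_sum _ fun i _ => (martingale_dyadicIntegral hM hc i).smul (w i)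

lemma memLp_dyadicIntegral (hM : Martingale M ℱ P) {c : ℝ} (hc : ∀ t ω, |M t ω| ≤ c)
    (n : ℕ) (t : ℝ≥0) : MemLp (dyadicIntegral M n t) 2 P :=
  memLp_of_bounded (ℱ.le t) ((martingale_dyadicIntegral hM hc n).1 t)
    (dyadicIntegral_bounded hc n t) 2

lemma memLp_combination (hM : Martingale M ℱ P) {c : ℝ} (hc : ∀ t ω, |M t ω| ≤ c)
    (w : ℕ →₀ ℝ) (t : ℝ≥0) : MemLp (combination M w t) 2 P := by
  rw [combination_eq]
  exact memLp_finsetSum' _ fun i _ => (memLp_dyadicIntegral hM hc i t).const_smul (w i)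

/-- By Cauchy–Schwarz; the constant depends on `w`, and only its independence of `t` matters. -/
lemma integral_combination_sq_le (hM : Martingale M ℱ P) {c : ℝ} (hc : ∀ t ω, |M t ω| ≤ c)
    (w : ℕ →₀ ℝ) : ∃ C, ∀ t, ∫ ω, combination M w t ω ^ 2 ∂P ≤ C := by
  refine ⟨w.support.card * ∑ i ∈ w.support, w i ^ 2 * (4 * c ^ 4), fun t => ?_⟩
  have hi : ∀ i, Integrable (fun ω => w i ^ 2 * dyadicIntegral M i t ω ^ 2) P := fun i =>
    (memLp_dyadicIntegral hM hc i t).integrable_sq.const_mul _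
  calc ∫ ω, combination M w t ω ^ 2 ∂P
      ≤ ∫ ω, w.support.card * ∑ i ∈ w.support, w i ^ 2 * dyadicIntegral M i t ω ^ 2 ∂P := by
        refine integral_mono (memLp_combination hM hc w t).integrable_sq
          ((integrable_finsetSum _ fun i _ => hi i).const_mul _) fun ω => ?_
        have := sq_sum_le_card_mul_sum_sq (s := w.support)
          (f := fun i => w i * dyadicIntegral M i t ω)
        simpa [combination_eq, Finset.sum_apply, mul_pow] using this
    _ = w.support.card * ∑ i ∈ w.support, w i ^ 2 * ∫ ω, dyadicIntegral M i t ω ^ 2 ∂P := by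
        rw [integral_const_mul, integral_finsetSum _ fun i _ => hi i]
        simp_rw [integral_const_mul]
    _ ≤ _ := by
        refine mul_le_mul_of_nonneg_left (Finset.sum_le_sum fun i _ => ?_) (Nat.cast_nonneg _)
        exact mul_le_mul_of_nonneg_left (integral_dyadicIntegral_sq_le hM hc i t) (sq_nonneg _)

/-- The functional minimized is `sup_t E (combination M w t)²`. Second moments of a martingale
increase in time, so the supremum is a limit and inherits the parallelogram law. -/
lemma exists_cauchy_combinations (hM : Martingale M ℱ P) {c : ℝ} (hc : ∀ t ω, |M t ω| ≤ c) :
    ∃ y : ℕ → ℕ →₀ ℝ, (∀ n, y n ∈ tailSimplex n) ∧ ∀ ε > 0, ∃ N, ∀ n ≥ N, ∀ m ≥ N, ∀ t,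
      ∫ ω, (combination M (y n) t ω - combination M (y m) t ω) ^ 2 ∂P ≤ ε := by
  set E : (ℕ →₀ ℝ) → ℝ≥0 → ℝ := fun w t => ∫ ω, combination M w t ω ^ 2 ∂P with hE
  have hbdd : ∀ w, BddAbove (Set.range (E w)) := fun w => by
    obtain ⟨C, hC⟩ := integral_combination_sq_le hM hc w
    exact ⟨C, by rintro _ ⟨t, rfl⟩; exact hC t⟩
  have hmono : ∀ w, Monotone (E w) := fun w s t hst =>
    integral_sq_mono (martingale_combination hM hc w) hst (memLp_combination hM hc w s)
      (memLp_combination hM hc w t)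
  have hlim : ∀ w, Tendsto (E w) atTop (𝓝 (⨆ t, E w t)) := fun w =>
    tendsto_atTop_ciSup (hmono w) (hbdd w)
  have hpar : ∀ v w t, E (v + w) t + E (v - w) t = 2 * E v t + 2 * E w t := fun v w t => by
    have hi := fun u => (memLp_combination hM hc u t).integrable_sq
    simp only [hE]
    rw [← integral_const_mul, ← integral_const_mul, ← integral_add (hi _) (hi _),
      ← integral_add ((hi v).const_mul 2) ((hi w).const_mul 2)]
    refine integral_congr_ae (.of_forall fun ω => ?_)
    simp only [combination_add, combination_sub]
    ring
  obtain ⟨y, hy, hq⟩ := exists_cauchy_weights (fun w => ⨆ t, E w t)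
    (fun w => (integral_nonneg fun ω => sq_nonneg _ : 0 ≤ E w 0).trans (le_ciSup (hbdd w) 0))
    (fun v w => tendsto_nhds_unique (((hlim _).add (hlim _)).congr (hpar v w))
      (((hlim v).const_mul 2).add ((hlim w).const_mul 2)))
    (C := 4 * c ^ 4) (fun n => ciSup_le fun t => by
      simp only [hE, combination_single]
      exact integral_dyadicIntegral_sq_le hM hc n t)
  refine ⟨y, hy, fun ε hε => ?_⟩
  obtain ⟨N, hN⟩ := hq ε hε
  refine ⟨N, fun n hn m hm t => ?_⟩
  simp_rw [← combination_sub]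
  exact (le_ciSup (hbdd _) t).trans (hN n hn m hm)

/-- The variance of `|f|` is nonnegative. -/
lemma integral_abs_le_of_integral_sq_le {f : Ω → ℝ} (hf : MemLp f 2 P) {δ : ℝ} (hδ : 0 ≤ δ)
    (h : ∫ ω, f ω ^ 2 ∂P ≤ δ ^ 2) : ∫ ω, |f ω| ∂P ≤ δ := by
  refine abs_le_of_sq_le_sq' ?_ hδ |>.2
  refine le_trans ?_ h
  have habs : MemLp (fun ω => |f ω|) 2 P := hf.norm
  have hi : Integrable (fun ω => |f ω|) P := habs.integrable (by norm_num)
  have hnn : 0 ≤ ∫ ω, (|f ω| - ∫ ω', |f ω'| ∂P) ^ 2 ∂P := integral_nonneg fun ω => sq_nonneg _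
  set a := ∫ ω', |f ω'| ∂P with ha
  have e : ∀ ω, (|f ω| - a) ^ 2 = f ω ^ 2 - 2 * a * |f ω| + a ^ 2 := fun ω => by
    rw [sub_sq, sq_abs]; ring
  simp_rw [e] at hnn
  have h2 : Integrable (fun ω => f ω ^ 2 - 2 * a * |f ω|) P :=
    hf.integrable_sq.sub (hi.const_mul _)
  rw [integral_add h2 (integrable_const _), integral_sub hf.integrable_sq (hi.const_mul _),
    integral_const_mul, ← ha] at hnn
  simp at hnn
  linarith

/-- Choose `φ` so that consecutive combinations differ by at most `4⁻ᵏ` in `L²`, hence in `L¹`. The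
maximal inequality at height `2⁻ᵏ` leaves an exceptional probability of at most `2⁻ᵏ`, which is
summable, and Borel–Cantelli applies. -/
lemma exists_ae_uniform_combinations (hM : Martingale M ℱ P)
    (hcadlag : ∀ ω, IsCadlag fun t => M t ω) {c : ℝ} (hc : ∀ t ω, |M t ω| ≤ c) :
    ∃ (y : ℕ → ℕ →₀ ℝ) (φ : ℕ → ℕ), (∀ n, y n ∈ tailSimplex n) ∧ Tendsto φ atTop atTop ∧
      (∀ ε > 0, ∃ N, ∀ n ≥ N, ∀ m ≥ N, ∀ t,
        ∫ ω, (combination M (y n) t ω - combination M (y m) t ω) ^ 2 ∂P ≤ ε) ∧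
      ∀ᵐ ω ∂P, ∃ f, TendstoUniformly (fun j => pathCombination (fun s => M s ω) (y (φ j)))
        f atTop := by
  obtain ⟨y, hy, hq⟩ := exists_cauchy_combinations hM hc
  have hev : ∀ k : ℕ, ∀ᶠ N in atTop, ∀ n ≥ N, ∀ m ≥ N, ∀ t,
      ∫ ω, (combination M (y n) t ω - combination M (y m) t ω) ^ 2 ∂P ≤ ((1 / 4) ^ k) ^ 2 := by
    intro k
    obtain ⟨N, hN⟩ := hq (((1 / 4) ^ k) ^ 2) (by positivity)
    filter_upwards [eventually_ge_atTop N] with N' hN' n hn m hm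
    exact hN n (hN'.trans hn) m (hN'.trans hm)
  obtain ⟨φ, hφ, hφN⟩ := extraction_forall_of_eventually hev
  refine ⟨y, φ, hy, hφ.tendsto_atTop, hq, ?_⟩
  set S : ℕ → Set Ω := fun k => {ω | ∃ t, (((1 / 2) ^ k : ℝ≥0) : ℝ) <
    |combination M (y (φ (k + 1)) - y (φ k)) t ω|} with hS
  have hPS : ∀ k, P (S k) ≤ (1 / 2 : ℝ≥0∞) ^ k := fun k => by
    have hmax := measure_exists_lt_abs_le (martingale_combination hM hc (y (φ (k + 1)) - y (φ k)))
      (fun ω t => pathCombination_rightCont (hcadlag ω t).1 _) (δ := (1 / 4) ^ k) (fun t => by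
        refine integral_abs_le_of_integral_sq_le (memLp_combination hM hc _ t) (by positivity) ?_
        simp_rw [combination_sub]
        exact hφN k _ (hφ k.lt_succ_self).le _ le_rfl t) ((1 / 2) ^ k)
    have e : ENNReal.ofReal ((1 / 4) ^ k) = (((1 / 2) ^ k : ℝ≥0) : ℝ≥0∞) * (1 / 2 : ℝ≥0∞) ^ k := by
      rw [show (1 / 2 : ℝ≥0∞) ^ k = (((1 / 2) ^ k : ℝ≥0) : ℝ≥0∞) by
          simp [ENNReal.inv_pow], ← ENNReal.coe_mul,
        ENNReal.ofReal, ENNReal.coe_inj, ← mul_pow]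
      ext
      rw [Real.coe_toNNReal _ (by positivity)]
      push_cast
      norm_num
    rw [e] at hmax
    exact (ENNReal.mul_le_mul_iff_right (by simp) (by simp)).1 hmax
  have hsum : ∑' k, P (S k) ≠ ∞ := by
    refine ne_top_of_le_ne_top ?_ (ENNReal.tsum_le_tsum hPS)
    rw [ENNReal.tsum_geometric]
    simp
  filter_upwards [ae_eventually_notMem hsum] with ω hω
  refine exists_tendstoUniformly_of_geometric ?_
  filter_upwards [hω] with k hk t
  simp only [hS, Set.mem_ofPred_eq, not_exists, not_lt] at hk
  have := hk t
  rw [combination_sub] at this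
  simpa [combination] using this

end

/-! ### The limit is a quadratic variation -/

section

variable {Ω : Type*} {mΩ : MeasurableSpace Ω} {P : Measure Ω}
  {ℱ : Filtration ℝ≥0 mΩ} {M A : ℝ≥0 → Ω → ℝ}

lemma eLpNorm_two_le {f : Ω → ℝ} (hf : MemLp f 2 P) {δ : ℝ} (hδ : 0 ≤ δ)
    (h : ∫ ω, f ω ^ 2 ∂P ≤ δ ^ 2) : eLpNorm f 2 P ≤ ENNReal.ofReal δ := by
  rw [hf.eLpNorm_eq_integral_rpow_norm (by norm_num) (by norm_num)]
  refine ENNReal.ofReal_le_ofReal ?_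
  simp only [ENNReal.toReal_ofNat, Real.rpow_ofNat, Real.norm_eq_abs, sq_abs]
  rw [← one_div, ← Real.sqrt_eq_rpow]
  exact Real.sqrt_le_iff.2 ⟨hδ, h⟩

lemma isCadlag_const (a : ℝ) : IsCadlag fun _ => a := fun _ =>
  ⟨continuousWithinAt_const, a, tendsto_const_nhds⟩

lemma pathCombination_limit_zero {m f : ℝ≥0 → ℝ} {w : ℕ → ℕ →₀ ℝ}
    (hf : TendstoUniformly (fun j => pathCombination m (w j)) f atTop) : f 0 = 0 := by
  have := hf.tendsto_at 0
  simp only [pathCombination_zero] at this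
  exact tendsto_nhds_unique this tendsto_const_nhds

lemma lintegral_terminal_le (hmono : ∀ ω, Monotone fun t => A t ω)
    (hmeas : ∀ t, Measurable (A t)) (hnn : ∀ t ω, 0 ≤ A t ω) (hi : ∀ t, Integrable (A t) P) {C : ℝ}
    (hC : ∀ t, ∫ ω, A t ω ∂P ≤ C) : ∫⁻ ω, terminal A ω ∂P ≤ ENNReal.ofReal C := by
  have e : ∀ ω, terminal A ω = ⨆ n : ℕ, ENNReal.ofReal (A n ω) := fun ω => by
    refine le_antisymm (iSup_le fun t => ?_) (iSup_le fun n => le_iSup_of_le (n : ℝ≥0) le_rfl)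
    obtain ⟨n, hn⟩ := exists_nat_ge t
    exact le_iSup_of_le n (ENNReal.ofReal_le_ofReal (hmono ω hn))
  simp_rw [e]
  rw [lintegral_iSup (fun n => (hmeas n).ennreal_ofReal) fun a b hab ω =>
    ENNReal.ofReal_le_ofReal (hmono ω (by exact_mod_cast hab))]
  refine iSup_le fun n => ?_
  rw [← ofReal_integral_eq_lintegral_ofReal (hi n) (.of_forall (hnn n))]
  exact ENNReal.ofReal_le_ofReal (hC n)

variable [IsProbabilityMeasure P]

/-- Convergence in `L¹` passes to integrals over each `U` in `ℱ s`, and these characterize the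
conditional expectation. -/
lemma martingale_of_tendsto_eLpNorm {X : ℝ≥0 → Ω → ℝ} {Y : ℕ → ℝ≥0 → Ω → ℝ}
    (hY : ∀ n, Martingale (Y n) ℱ P) (hX : StronglyAdapted ℱ X) (hi : ∀ t, Integrable (X t) P)
    (hlim : ∀ t, Tendsto (fun n => eLpNorm (Y n t - X t) 1 P) atTop (𝓝 0)) :
    Martingale X ℱ P := by
  refine ⟨hX, fun s t hst => ?_⟩
  refine (ae_eq_condExp_of_forall_setIntegral_eq (ℱ.le s) (hi t)
    (fun _ _ _ => (hi s).integrableOn) (fun U hU _ => ?_)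
    (hX s).aestronglyMeasurable).symm
  have h : ∀ t, Tendsto (fun n => ∫ ω in U, Y n t ω ∂P) atTop (𝓝 (∫ ω in U, X t ω ∂P)) :=
    fun t => tendsto_setIntegral_of_L1' (X t) (hi t).aestronglyMeasurable
      (.of_forall fun n => (hY n).integrable t) (hlim t) U
  exact tendsto_nhds_unique (h s)
    ((h t).congr fun n => ((hY n).setIntegral_eq hst hU).symm)

/-- A uniform limit of tail convex combinations of dyadic integrals, subtracted from `M²`, is a
quadratic variation of `M`. -/
lemma isQuadVar_of_tendstoUniformly (hℱ : UsualConditions ℱ P) (hM : Martingale M ℱ P)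
    (hcadlag : ∀ ω, IsCadlag fun t => M t ω) {c : ℝ} (hc : ∀ t ω, |M t ω| ≤ c)
    (hzero : ∀ ω, M 0 ω = 0) {y : ℕ → ℕ →₀ ℝ} {φ : ℕ → ℕ} (hy : ∀ n, y n ∈ tailSimplex n)
    (hφ : Tendsto φ atTop atTop)
    (hq : ∀ ε > 0, ∃ N, ∀ n ≥ N, ∀ m ≥ N, ∀ t,
      ∫ ω, (combination M (y n) t ω - combination M (y m) t ω) ^ 2 ∂P ≤ ε)
    {G : Set Ω} (hG : ∀ᵐ ω ∂P, ω ∈ G)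
    (hAG : ∀ ω ∈ G, TendstoUniformly (fun j => pathCombination (fun s => M s ω) (y (φ j)))
      (fun t => M t ω ^ 2 - A t ω) atTop)
    (hA0 : ∀ ω, ω ∉ G → ∀ t, A t ω = 0) :
    IsQuadVar ℱ P M A ∧ Tendsto (fun n => ⨆ t, eLpNorm (fun ω => (M t ω ^ 2 - A t ω) -
      combination M (y n) t ω) 2 P) atTop (𝓝 0) := by
  have hyφ : ∀ k, y (φ k) ∈ tailSimplex (φ k) := fun k => hy _
  have hGm : ∀ t, MeasurableSet[ℱ t] G := fun t => by
    -- The usual conditions put the exceptional null set into `ℱ 0`, so setting `A` to zero there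
    -- keeps it adapted.
    have : MeasurableSet[ℱ 0] Gᶜ := hℱ.null _ hG
    exact ℱ.mono (zero_le (a := t)) _ this.of_compl
  have eA : ∀ ω, (fun t => A t ω) = fun t => M t ω ^ 2 - (M t ω ^ 2 - A t ω) := fun ω => by
    ext t; ring
  have eA0 : ∀ ω, ω ∉ G → (fun t => A t ω) = fun _ => 0 := fun ω hω => funext (hA0 ω hω)
  have hAcad : ∀ ω, IsCadlag fun t => A t ω := fun ω => by
    by_cases hω : ω ∈ G
    · rw [eA ω]
      exact (hcadlag ω).sq_sub_limit hφ hyφ (hAG ω hω)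
    · rw [eA0 ω hω]
      exact isCadlag_const 0
  have hAmono : ∀ ω, Monotone fun t => A t ω := fun ω => by
    by_cases hω : ω ∈ G
    · rw [eA ω]
      exact monotone_sq_sub_limit (fun t => (hcadlag ω t).1) hφ hyφ (hAG ω hω)
    · rw [eA0 ω hω]
      exact monotone_const
  have hAzero : ∀ ω, A 0 ω = 0 := fun ω => by
    by_cases hω : ω ∈ G
    · have := pathCombination_limit_zero (hAG ω hω)
      simp only [hzero ω] at this
      linarith
    · exact hA0 ω hω 0
  have hAnn : ∀ t ω, 0 ≤ A t ω := fun t ω => (hAzero ω).symm.le.trans (hAmono ω (zero_le (a := t)))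
  have hAad : StronglyAdapted ℱ A := fun t => by
    refine stronglyMeasurable_of_tendsto atTop (f := fun j => G.indicator fun ω =>
      M t ω ^ 2 - combination M (y (φ j)) t ω) (fun j => ?_) ?_
    · exact (((hM.1 t).pow 2).sub ((martingale_combination hM hc _).1 t)).indicator (hGm t)
    · refine tendsto_pi_nhds.2 fun ω => ?_
      by_cases hω : ω ∈ G
      · simp only [Set.indicator_of_mem hω]
        have := (tendsto_const_nhds (x := M t ω ^ 2)).sub ((hAG ω hω).tendsto_at t)
        simpa [combination] using this
      · simp [hω, hA0 ω hω t]
  have hNad : StronglyAdapted ℱ fun t ω => M t ω ^ 2 - A t ω := fun t =>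
    ((hM.1 t).pow 2).sub (hAad t)
  have hcm : ∀ n t, MemLp (combination M (y n) t) 2 P := fun n t => memLp_combination hM hc _ t
  -- Fatou's lemma along `φ`: the Cauchy bound between combinations survives when one of them is
  -- replaced by its almost sure limit.
  have hclose : ∀ δ > 0, ∃ N, ∀ n ≥ N, ∀ t, eLpNorm (fun ω => (M t ω ^ 2 - A t ω) -
      combination M (y n) t ω) 2 P ≤ ENNReal.ofReal δ := by
    intro δ hδ
    obtain ⟨N, hN⟩ := hq (δ ^ 2) (by positivity)
    refine ⟨N, fun n hn t => ?_⟩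
    refine (Lp.eLpNorm_lim_le_liminf_eLpNorm (f := fun j ω => combination M (y (φ j)) t ω -
      combination M (y n) t ω) (fun j => ((hcm _ t).sub (hcm n t)).aestronglyMeasurable) _ ?_).trans
      ?_
    · filter_upwards [hG] with ω hω
      exact ((hAG ω hω).tendsto_at t).sub_const _
    · refine liminf_le_of_le (by isBoundedDefault) fun b hb => ?_
      obtain ⟨j, hj, hjN⟩ := (hb.and (hφ.eventually_ge_atTop N)).exists
      exact hj.trans (eLpNorm_two_le ((hcm _ t).sub (hcm n t)) hδ.le (hN _ hjN n hn t))
  have hlim : Tendsto (fun n => ⨆ t, eLpNorm (fun ω => (M t ω ^ 2 - A t ω) -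
      combination M (y n) t ω) 2 P) atTop (𝓝 0) := by
    refine ENNReal.tendsto_nhds_zero.2 fun ε hε => ?_
    obtain ⟨δ, hδ, hδε⟩ : ∃ δ : ℝ, 0 < δ ∧ ENNReal.ofReal δ ≤ ε := by
      obtain ⟨r, hr, hrε⟩ := ENNReal.lt_iff_exists_nnreal_btwn.1 hε
      exact ⟨r, by exact_mod_cast hr, by simpa using hrε.le⟩
    obtain ⟨N, hN⟩ := hclose δ hδ
    filter_upwards [eventually_ge_atTop N] with n hn
    exact iSup_le fun t => (hN n hn t).trans hδε
  have hsm : ∀ t, AEStronglyMeasurable (fun ω => M t ω ^ 2 - A t ω) P := fun t =>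
    ((hNad t).mono (ℱ.le t)).aestronglyMeasurable
  -- A single combination, `L²`-bounded in time and within distance `1` of the limit, bounds the
  -- limit.
  obtain ⟨C, hC⟩ : ∃ C : ℝ, ∀ t, eLpNorm (fun ω => M t ω ^ 2 - A t ω) 2 P ≤ ENNReal.ofReal C := by
    obtain ⟨n, hn⟩ := hclose 1 one_pos
    obtain ⟨C, hC⟩ := integral_combination_sq_le hM hc (y n)
    have hC0 : 0 ≤ C := (integral_nonneg fun ω => sq_nonneg _).trans (hC 0)
    refine ⟨1 + √C, fun t => ?_⟩
    have h1 := eLpNorm_add_le ((hsm t).sub (hcm n t).aestronglyMeasurable)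
      (hcm n t).aestronglyMeasurable (p := 2) (by norm_num)
    rw [sub_add_cancel] at h1
    refine h1.trans ?_
    rw [ENNReal.ofReal_add zero_le_one (Real.sqrt_nonneg _)]
    refine add_le_add (hn n le_rfl t) (eLpNorm_two_le (hcm n t) (Real.sqrt_nonneg _) ?_)
    rw [Real.sq_sqrt hC0]
    exact hC t
  have hN2 : ∀ t, MemLp (fun ω => M t ω ^ 2 - A t ω) 2 P := fun t =>
    ⟨hsm t, (hC t).trans_lt ENNReal.ofReal_lt_top⟩
  have hmart : Martingale (fun t ω => M t ω ^ 2 - A t ω) ℱ P := by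
    refine martingale_of_tendsto_eLpNorm (Y := fun n => combination M (y n))
      (fun n => martingale_combination hM hc _) hNad (fun t => (hN2 t).integrable (by norm_num))
      fun t => ?_
    refine tendsto_of_tendsto_of_tendsto_of_le_of_le tendsto_const_nhds hlim (fun _ => zero_le)
      fun n => ?_
    refine le_trans ?_ (le_iSup (fun t => eLpNorm (fun ω => (M t ω ^ 2 - A t ω) -
      combination M (y n) t ω) 2 P) t)
    rw [eLpNorm_sub_comm]
    exact eLpNorm_le_eLpNorm_of_exponent_le (by norm_num)
      ((hsm t).sub (hcm n t).aestronglyMeasurable)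
  have hM2 : ∀ t, MemLp (M t) 2 P := fun t => memLp_of_bounded (ℱ.le t) (hM.1 t) ⟨c, hc t⟩ 2
  have hAi : ∀ t, Integrable (A t) P := fun t => by
    have := (hM2 t).integrable_sq.sub ((hN2 t).integrable (by norm_num))
    refine this.congr (.of_forall fun ω => ?_)
    simp
  -- The martingale `M² - A` starts at zero, so `E A_t = E M_t² ≤ c²`.
  have hAint : ∀ t, ∫ ω, A t ω ∂P ≤ c ^ 2 := fun t => by
    have h0 := hmart.setIntegral_eq (zero_le (a := t)) (s := Set.univ) MeasurableSet.univ
    simp only [setIntegral_univ, hzero, hAzero] at h0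
    rw [integral_sub (hM2 t).integrable_sq (hAi t)] at h0
    have h1 := integral_mono (μ := P) (hM2 t).integrable_sq (integrable_const (c ^ 2))
      fun ω => sq_le_sq' (abs_le.1 (hc t ω)).1 (abs_le.1 (hc t ω)).2
    simp at h0 h1
    linarith
  refine ⟨⟨⟨hAad, hAcad, hAzero, hAmono, ?_⟩, ⟨hmart, fun ω t => ⟨((hcadlag ω t).1.pow 2).sub
    (hAcad ω t).1, ?_⟩, fun ω => by simp [hzero, hAzero], ?_⟩, ?_⟩, hlim⟩
  · exact (lintegral_terminal_le hAmono (fun t => ((hAad t).mono (ℱ.le t)).measurable) hAnn hAi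
      hAint).trans_lt ENNReal.ofReal_lt_top
  · obtain ⟨l, hl⟩ := (hcadlag ω t).2
    obtain ⟨l', hl'⟩ := (hAcad ω t).2
    exact ⟨_, (hl.pow 2).sub hl'⟩
  · exact (iSup_le hC).trans_lt ENNReal.ofReal_lt_top
  · filter_upwards [hG] with ω hω t
    rw [eA ω]
    exact jump_sq_sub_limit (hcadlag ω) hφ hyφ (hAG ω hω) t

lemma exists_isQuadVar (hℱ : UsualConditions ℱ P) (hM : Martingale M ℱ P)
    (hcadlag : ∀ ω, IsCadlag fun t => M t ω) {c : ℝ} (hc : ∀ t ω, |M t ω| ≤ c)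
    (hzero : ∀ ω, M 0 ω = 0) :
    ∃ (A : ℝ≥0 → Ω → ℝ) (y : ℕ → ℕ →₀ ℝ), (∀ n, y n ∈ tailSimplex n) ∧ IsQuadVar ℱ P M A ∧
      Tendsto (fun n => ⨆ t, eLpNorm (fun ω => (M t ω ^ 2 - A t ω) -
        combination M (y n) t ω) 2 P) atTop (𝓝 0) := by
  classical
  obtain ⟨y, φ, hy, hφ, hq, hG⟩ := exists_ae_uniform_combinations hM hcadlag hc
  refine ⟨fun t ω => if h : ∃ f, TendstoUniformly
    (fun j => pathCombination (fun s => M s ω) (y (φ j))) f atTop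
    then M t ω ^ 2 - h.choose t else 0, y, hy, ?_⟩
  refine isQuadVar_of_tendstoUniformly hℱ hM hcadlag hc hzero hy hφ hq hG (fun ω hω => ?_)
    fun ω hω t => dif_neg hω
  have hω' : ∃ f, TendstoUniformly
    (fun j => pathCombination (fun s => M s ω) (y (φ j))) f atTop := hω
  simp only [dif_pos hω', sub_sub_cancel]
  exact hω'.choose_spec

end

/-! ### Uniqueness: continuous martingales of finite variation -/

section

section Path

lemma continuous_sub_of_jump_eq {f g : ℝ≥0 → ℝ} (hf : IsCadlag f) (hg : IsCadlag g)
    (h : ∀ t, jump f t = jump g t) : Continuous fun t => f t - g t := by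
  refine continuous_iff_continuousAt.2 fun t => ?_
  rw [ContinuousAt, ← nhdsLT_sup_nhdsGE t]
  refine Tendsto.sup ?_ ((hf t).1.sub (hg t).1)
  rcases eq_zero_or_pos t with rfl | ht
  · simp
  · obtain ⟨l, hl⟩ := (hf t).2
    obtain ⟨l', hl'⟩ := (hg t).2
    have ht' := h t
    rw [jump_eq ht hl, jump_eq ht hl'] at ht'
    have e : f t - g t = l - l' := by linarith
    simp only [e]
    exact hl.sub hl'

/-- The uniform grid of `[0, t]` with `n + 1` cells. -/
noncomputable def grid (t : ℝ≥0) (n k : ℕ) : ℝ≥0 := t * (k / (n + 1))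

lemma monotone_grid (t : ℝ≥0) (n : ℕ) : Monotone (grid t n) := fun a b h => by
  unfold grid
  gcongr

lemma grid_zero (t : ℝ≥0) (n : ℕ) : grid t n 0 = 0 := by simp [grid]

lemma grid_last (t : ℝ≥0) (n : ℕ) : grid t n (n + 1) = t := by
  unfold grid
  push_cast
  rw [div_self (by positivity), mul_one]

variable {a b : ℝ≥0 → ℝ}

lemma abs_sub_le_of_monotone (ha : Monotone a) (hb : Monotone b) {s t : ℝ≥0} (h : s ≤ t) :
    |(a t - b t) - (a s - b s)| ≤ (a t + b t) - (a s + b s) := by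
  have := ha h
  have := hb h
  rw [abs_le]
  constructor <;> linarith

/-- One factor of each square is bounded by `ε`, the other by the increment of `a + b`, and the
latter increments telescope. -/
lemma sum_sq_grid_le (ha : Monotone a) (hb : Monotone b) (ha0 : a 0 = 0) (hb0 : b 0 = 0)
    (t : ℝ≥0) (n : ℕ) {ε : ℝ} (hε : ∀ k < n + 1, |(a (grid t n (k + 1)) - b (grid t n (k + 1))) -
      (a (grid t n k) - b (grid t n k))| ≤ ε) :
    ∑ k ∈ Finset.range (n + 1), ((a (grid t n (k + 1)) - b (grid t n (k + 1))) -
      (a (grid t n k) - b (grid t n k))) ^ 2 ≤ ε * (a t + b t) := by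
  have hsum : ∑ k ∈ Finset.range (n + 1), ((a (grid t n (k + 1)) + b (grid t n (k + 1))) -
      (a (grid t n k) + b (grid t n k))) = a t + b t := by
    rw [Finset.sum_range_sub fun k => a (grid t n k) + b (grid t n k), grid_last, grid_zero,
      ha0, hb0]
    ring
  rw [← hsum, Finset.mul_sum]
  refine Finset.sum_le_sum fun k hk => ?_
  rw [← sq_abs, sq]
  exact mul_le_mul (hε k (Finset.mem_range.1 hk))
    (abs_sub_le_of_monotone ha hb (monotone_grid t n k.le_succ)) (abs_nonneg _)
    ((abs_nonneg _).trans (hε k (Finset.mem_range.1 hk)))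

/-- This bound does not depend on `n` and serves as the dominating function in the uniqueness proof.
-/
lemma sum_sq_grid_le_sq (ha : Monotone a) (hb : Monotone b) (ha0 : a 0 = 0) (hb0 : b 0 = 0)
    (t : ℝ≥0) (n : ℕ) :
    ∑ k ∈ Finset.range (n + 1), ((a (grid t n (k + 1)) - b (grid t n (k + 1))) -
      (a (grid t n k) - b (grid t n k))) ^ 2 ≤ (a t + b t) ^ 2 := by
  rw [sq (a t + b t)]
  refine sum_sq_grid_le ha hb ha0 hb0 t n fun k hk => ?_
  refine (abs_sub_le_of_monotone ha hb (monotone_grid t n k.le_succ)).trans ?_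
  have hkt : grid t n (k + 1) ≤ t := by
    simpa only [grid_last] using monotone_grid t n (Nat.succ_le_of_lt hk)
  have := ha hkt
  have := hb hkt
  have := ha (zero_le (a := grid t n k))
  have := hb (zero_le (a := grid t n k))
  linarith

lemma tendsto_sum_sq_grid (ha : Monotone a) (hb : Monotone b) (ha0 : a 0 = 0) (hb0 : b 0 = 0)
    (hc : Continuous fun t => a t - b t) (t : ℝ≥0) :
    Tendsto (fun n => ∑ k ∈ Finset.range (n + 1),
      ((a (grid t n (k + 1)) - b (grid t n (k + 1))) -
      (a (grid t n k) - b (grid t n k))) ^ 2) atTop (𝓝 0) := by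
  have hV : 0 ≤ a t + b t := by
    have := ha (zero_le (a := t))
    have := hb (zero_le (a := t))
    linarith
  have hu := isCompact_Icc.uniformContinuousOn_of_continuous (hc.continuousOn (s := Set.Icc 0 t))
  rw [Metric.uniformContinuousOn_iff] at hu
  rw [Metric.tendsto_atTop]
  intro ε hε
  -- The `+ 1` keeps the denominator positive when `a t + b t = 0`.
  obtain ⟨δ, hδ, h⟩ := hu (ε / (2 * (a t + b t + 1))) (by positivity)
  have hlim : Tendsto (fun n : ℕ => (t : ℝ) * (1 / ((n : ℝ) + 1))) atTop (𝓝 0) := by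
    simpa using (tendsto_one_div_add_atTop_nhds_zero_nat (𝕜 := ℝ)).const_mul (t : ℝ)
  obtain ⟨N, hN⟩ := eventually_atTop.1 (hlim.eventually (gt_mem_nhds hδ))
  refine ⟨N, fun n hn => ?_⟩
  rw [Real.dist_eq, sub_zero, abs_of_nonneg (Finset.sum_nonneg fun k _ => sq_nonneg _)]
  refine (sum_sq_grid_le ha hb ha0 hb0 t n (ε := ε / (2 * (a t + b t + 1)))
    fun k hk => ?_).trans_lt ?_
  · have hm : ∀ j ≤ n + 1, grid t n j ∈ Set.Icc 0 t := fun j hj =>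
      ⟨zero_le, by simpa only [grid_last] using monotone_grid t n hj⟩
    have := h (grid t n (k + 1)) (hm _ (Nat.succ_le_of_lt hk)) (grid t n k) (hm _ hk.le) (by
      rw [NNReal.dist_eq]
      refine lt_of_eq_of_lt ?_ (hN n hn)
      unfold grid
      push_cast
      rw [← mul_sub, ← sub_div, add_sub_cancel_left, abs_of_nonneg (by positivity)])
    exact (Real.dist_eq _ _ ▸ this).le
  · rw [div_mul_eq_mul_div, div_lt_iff₀ (by positivity)]
    nlinarith

end Path

variable {Ω : Type*} {mΩ : MeasurableSpace Ω} {P : Measure Ω} [IsProbabilityMeasure P]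
  {ℱ : Filtration ℝ≥0 mΩ} {M A B : ℝ≥0 → Ω → ℝ}

/-- Both `M²` and `M² - A` are in `L²`. This makes `(A + B)²` integrable for the dominated
convergence below. -/
lemma IsQuadVar.memLp (hM : Martingale M ℱ P) {c : ℝ} (hc : ∀ t ω, |M t ω| ≤ c)
    (hA : IsQuadVar ℱ P M A) (t : ℝ≥0) : MemLp (A t) 2 P := by
  have h1 : MemLp (fun ω => M t ω ^ 2) 2 P :=
    memLp_of_bounded (ℱ.le t) ((hM.1 t).pow 2) ⟨c ^ 2, fun ω => by
      rw [Pi.pow_apply, abs_pow]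
      exact pow_le_pow_left₀ (abs_nonneg _) (hc t ω) 2⟩ 2
  have h2 : MemLp (fun ω => M t ω ^ 2 - A t ω) 2 P :=
    ⟨(hA.martingale.martingale.integrable t).aestronglyMeasurable,
      (le_iSup (fun t => eLpNorm (fun ω => M t ω ^ 2 - A t ω) 2 P) t).trans_lt
        hA.martingale.bounded⟩
  refine (h1.sub h2).ae_eq (.of_forall fun ω => ?_)
  simp

lemma IsQuadVar.indistinguishable (hM : Martingale M ℱ P) {c : ℝ} (hc : ∀ t ω, |M t ω| ≤ c)
    (hA : IsQuadVar ℱ P M A) (hB : IsQuadVar ℱ P M B) : Indistinguishable P A B := by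
  have hD : Martingale (fun t ω => A t ω - B t ω) ℱ P := by
    have := hB.martingale.martingale.sub hA.martingale.martingale
    convert this using 1
    ext t ω
    simp
  have hA2 := hA.memLp hM hc
  have hB2 := hB.memLp hM hc
  have hD2 : ∀ t, MemLp (fun ω => A t ω - B t ω) 2 P := fun t => (hA2 t).sub (hB2 t)
  have hcont : ∀ᵐ ω ∂P, Continuous fun t => A t ω - B t ω := by
    filter_upwards [hA.jumps, hB.jumps] with ω h1 h2
    exact continuous_sub_of_jump_eq (hA.increasing.cadlag ω) (hB.increasing.cadlag ω)
      fun t => (h1 t).trans (h2 t).symm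
  have hzero : ∀ t, ∀ᵐ ω ∂P, A t ω - B t ω = 0 := fun t => by
    -- Orthogonality of increments and `A 0 = B 0 = 0` make the left side independent of the grid,
    -- while the integrand tends to zero as the mesh shrinks.
    have hint : ∀ n, ∫ ω, ∑ k ∈ Finset.range (n + 1),
        ((A (grid t n (k + 1)) ω - B (grid t n (k + 1)) ω) -
        (A (grid t n k) ω - B (grid t n k) ω)) ^ 2 ∂P = ∫ ω, (A t ω - B t ω) ^ 2 ∂P := fun n => by
      rw [integral_sum_sq_sub (Martingale.sampled hD (monotone_grid t n)) (fun k => hD2 _) (n + 1)]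
      simp [grid_last, grid_zero, hA.increasing.zero, hB.increasing.zero]
    have hlim := tendsto_integral_of_dominated_convergence (μ := P)
      (F := fun n ω => ∑ k ∈ Finset.range (n + 1),
        ((A (grid t n (k + 1)) ω - B (grid t n (k + 1)) ω) -
        (A (grid t n k) ω - B (grid t n k) ω)) ^ 2) (f := fun _ => (0 : ℝ))
      (fun ω => (A t ω + B t ω) ^ 2)
      (fun n => Finset.aestronglyMeasurable_fun_sum _ fun k _ =>
        (((hD2 _).sub (hD2 _)).aestronglyMeasurable.pow 2))
      ((hA2 t).add (hB2 t)).integrable_sq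
      (fun n => .of_forall fun ω => by
        rw [Real.norm_of_nonneg (Finset.sum_nonneg fun k _ => sq_nonneg _)]
        exact sum_sq_grid_le_sq (hA.increasing.mono ω) (hB.increasing.mono ω)
          (hA.increasing.zero ω) (hB.increasing.zero ω) t n)
      (by
        filter_upwards [hcont] with ω hω
        exact tendsto_sum_sq_grid (hA.increasing.mono ω) (hB.increasing.mono ω)
          (hA.increasing.zero ω) (hB.increasing.zero ω) hω t)
    simp only [hint, integral_zero] at hlim
    have h0 := tendsto_nhds_unique tendsto_const_nhds hlim
    rw [integral_eq_zero_iff_of_nonneg (fun ω => sq_nonneg _) (hD2 t).integrable_sq] at h0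
    filter_upwards [h0] with ω hω
    simpa using hω
  have hall : ∀ᵐ ω ∂P, ∀ n k, A (dyadic n k) ω - B (dyadic n k) ω = 0 :=
    ae_all_iff.2 fun n => ae_all_iff.2 fun k => hzero _
  filter_upwards [hall] with ω hω t
  obtain ⟨n, k, h⟩ := exists_seq_dyadic t
  have := ((hA.increasing.cadlag ω t).1.sub (hB.increasing.cadlag ω t).1).tendsto.comp h
  have h0 := tendsto_nhds_unique (this.congr fun i => hω (n i) (k i)) tendsto_const_nhds
  simp only [Pi.sub_apply] at h0
  linarith

end

end QuadVar

/-! ### The main theorem -/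

theorem lemma3p1 {Ω : Type*} {mΩ : MeasurableSpace Ω} (P : Measure Ω) [IsProbabilityMeasure P]
    (ℱ : Filtration ℝ≥0 mΩ) (hℱ : QuadVar.UsualConditions ℱ P)
    (M : ℝ≥0 → Ω → ℝ) (hM : Martingale M ℱ P)
    (hcadlag : ∀ ω, QuadVar.IsCadlag fun t => M t ω)
    (hbdd : ∃ c : ℝ, ∀ t ω, |M t ω| ≤ c)
    (hzero : ∀ ω, M 0 ω = 0) :
    ∃ A : ℝ≥0 → Ω → ℝ, QuadVar.IsQuadVar ℱ P M A ∧
      (∀ B : ℝ≥0 → Ω → ℝ, QuadVar.IsQuadVar ℱ P M B → QuadVar.Indistinguishable P B A) ∧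
      ∃ (K : ℕ → ℕ) (w : ℕ → ℕ → ℝ),
        (∀ n, n ≤ K n) ∧ (∀ n, ∀ i ∈ Finset.Icc n (K n), 0 ≤ w n i) ∧
        (∀ n, ∑ i ∈ Finset.Icc n (K n), w n i = 1) ∧
        Tendsto (fun n => ⨆ t, eLpNorm (fun ω => (M t ω ^ 2 - A t ω) -
          ∑ i ∈ Finset.Icc n (K n), w n i * QuadVar.dyadicIntegral M i t ω) 2 P)
          atTop (𝓝 0) := by
  obtain ⟨c, hc⟩ := hbdd
  obtain ⟨A, y, hy, hA, hlim⟩ := QuadVar.exists_isQuadVar hℱ hM hcadlag hc hzero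
  -- The last index is the largest in the support of `y n`; the maximum with `n` makes `n ≤ K n`
  -- immediate.
  have hsupp : ∀ n, (y n).support ⊆ Finset.Icc n (max n ((y n).support.sup id)) := by
    intro n i hi
    refine Finset.mem_Icc.2 ⟨?_, le_max_of_le_right (Finset.le_sup (f := id) hi)⟩
    by_contra hlt
    exact (Finsupp.mem_support_iff.1 hi) ((hy n).2.1 i (by omega))
  refine ⟨A, hA, fun B hB => hB.indistinguishable hM hc hA,
    fun n => max n ((y n).support.sup id), fun n i => y n i, fun n => le_max_left _ _,
    fun n i _ => (hy n).1 i, fun n => ?_, ?_⟩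
  · rw [← (hy n).2.2]
    exact (Finset.sum_subset (hsupp n) fun i _ hi => Finsupp.notMem_support_iff.1 hi).symm
  · refine hlim.congr fun n => iSup_congr fun t => ?_
    congr 1
    ext ω
    congr 1
    exact Finset.sum_subset (hsupp n) fun i _ hi => by
      simp [Finsupp.notMem_support_iff.1 hi]
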